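/- **Setting.** Let $d, q \ge 1$ and $m \ge 0$ be integers. Fix arbitrary norms on $\mathbb{R}^d$ and $\mathbb{R}^q$, and the corresponding operator norm on $\mathbb{R}^{d\times q}$; all are denoted by $\|\cdot\|$. Let $(\xi_t)_{t\in\mathbb{Z}}$ be independent and identically distributed random vectors in $\mathbb{R}^q$, and let $\{C_i(t) : i = 0,\dots,m;\ t\in\mathbb{Z}\}$ be an array of random $d\times q$ matrices, independent of $(\xi_t)_{t\in\mathbb{Z}}$ and such that the process $t \mapsto (C_0(t),\dots,C_m(t))$ is (strictly) stationary. Define $$X_t = \sum_{i=0}^m C_i(t)\,\xi_{t-i}, \qquad t\in\mathbb{Z}.$$ **Regular variation.** A random vector $Z$ in $\mathbb{R}^k$ is regularly varying of index $\alpha\in(0,\infty)$ with spectral measure $\mathcal{L}(\Theta)$ with respect to a norm $|\cdot|$ on $\mathbb{R}^k$ if $\Theta$ is a random vector with $|\Theta| = 1$ almost surely and, for every $u\in(0,\infty)$, $$\frac{1}{\Pr(|Z|>x)}\Pr\bigl(|Z|>ux,\ Z/|Z|\in\cdot\,\bigr)\ \longrightarrow\ u^{-\alpha}\Pr(\Theta\in\cdot\,),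 \qquad x\to\infty,$$ weakly as finite measures; it is regularly varying of index $\alpha$ if this holds for some norm and some $\Theta$. A stationary process $(X_t)_{t\in\mathbb{Z}}$ in $\mathbb{R}^d$ is jointly regularly varying of index $\alpha$ if for every integer $k \ge 1$ the random vector $(X_1,\dots,X_k)$ in $\mathbb{R}^{kd}$ is regularly varying of index $\alpha$. **Theorem 2.8.** Assume: - (M1) $\xi_0$ is regularly varying of index $\alpha\in(0,\infty)$ with spectral measure $\mathcal{L}(\Theta)$ with respect to the given norm on $\mathbb{R}^q$, where $\Theta$ is taken independent of the array $\{C_i(t)\}$; - (M2) there exists $\beta>\alpha$ such that $\mathrm{E}\|C_i(0)\|^\beta<\infty$ for $i=0,\dots,m$; - (M3) there exists $i\in\{0,\dots,m\}$ such that $\Pr(\|C_i(0)\Theta\|>0)>0$. Then $(X_t)_{t\in\mathbb{Z}}$ is stationary and jointly regularly varying of index $\alpha$. As $x\to\infty$, $$\frac{\Pr(\|X_0\|>x)}{\Pr(\|\xi_0\|>x)}\ \longrightarrow\ c := \sum_{i=0}^m \mathrm{E}\|C_i(0)\Theta\|^\alpha, \qquad 0<c<\infty.$$ Moreover, for all integers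 $s\le t$ and every bounded continuous $f:(\mathbb{R}^d)^{t-s+1}\to\mathbb{R}$, as $x\to\infty$, $$\mathrm{E}\left[f\left(\frac{X_s}{\|X_0\|},\dots,\frac{X_t}{\|X_0\|}\right)\,\middle|\,\|X_0\|>x\right]\ \longrightarrow\ \frac1c\sum_{i=0}^m\mathrm{E}\left[f\left(\frac{C_{i+s}(s)\Theta}{\|C_i(0)\Theta\|},\dots,\frac{C_{i+t}(t)\Theta}{\|C_i(0)\Theta\|}\right)\|C_i(0)\Theta\|^\alpha\right],$$ where $C_j(\cdot)=0$ if $j<0$ or $j>m$, and the expectation on the right is over the event $\{C_i(0)\Theta\ne 0\}$ (the integrand is read as $0$ where $C_i(0)\Theta=0$). -/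

import Mathlib

open MeasureTheory ProbabilityTheory Filter
open scoped Topology NNReal ENNReal BoundedContinuousFunction

namespace MMA

noncomputable section

/-- A seminorm that vanishes only at `0`, i.e. a norm. It ranges over all norms on the vector
space `V`, independently of the norm that `V` carries as an instance. -/
def IsNorm {V : Type*} [AddCommGroup V] [Module ℝ V] (p : Seminorm ℝ V) : Prop :=
  ∀ v : V, p v = 0 → v = 0

/-- The finite measure
`P(p(X) > x)⁻¹ · P(p(X) > u x, X / p(X) ∈ · )` on `V`, where `p` is a norm on `V`. -/
def angularMeasure {Ω V : Type*} [MeasurableSpace Ω] [AddCommGroup V] [Module ℝ V]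
    [MeasurableSpace V] (P : Measure Ω) [IsProbabilityMeasure P]
    (p : Seminorm ℝ V) (X : Ω → V) (u x : ℝ) : FiniteMeasure V :=
  let ν : FiniteMeasure V :=
    ⟨(P.restrict {ω | u * x < p (X ω)}).map (fun ω => (p (X ω))⁻¹ • X ω), inferInstance⟩
  (P {ω | x < p (X ω)}).toNNReal⁻¹ • ν

/-- The random vector `X` in the finite-dimensional space `V` is regularly varying of index
`α ∈ (0, ∞)`, with spectral measure `S` with respect to the norm `p`: the law `S` is carried by the
unit sphere of `p`, and for every `u > 0`, as `x → ∞`,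
`P(p(X) > x)⁻¹ · P(p(X) > u x, X / p(X) ∈ · ) → u ^ (-α) · S` weakly, as finite measures. -/
structure IsRegularlyVaryingWith {Ω V : Type*} [MeasurableSpace Ω]
    [NormedAddCommGroup V] [NormedSpace ℝ V] [FiniteDimensional ℝ V]
    [MeasurableSpace V] [BorelSpace V]
    (P : Measure Ω) [IsProbabilityMeasure P] (p : Seminorm ℝ V) (α : ℝ) (X : Ω → V)
    (S : ProbabilityMeasure V) : Prop where
  index_pos : 0 < α
  isNorm : IsNorm p
  sphere : ∀ᵐ θ ∂(S : Measure V), p θ = 1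
  tendsto : ∀ u : ℝ≥0, 0 < u →
    Tendsto (fun x : ℝ => angularMeasure P p X u x) atTop
      (𝓝 (u ^ (-α) • S.toFiniteMeasure))

/-- The random vector `X` is regularly varying of index `α`: for some norm on `V` it has a
spectral measure. -/
def IsRegularlyVarying {Ω V : Type*} [MeasurableSpace Ω]
    [NormedAddCommGroup V] [NormedSpace ℝ V] [FiniteDimensional ℝ V]
    [MeasurableSpace V] [BorelSpace V]
    (P : Measure Ω) [IsProbabilityMeasure P] (α : ℝ) (X : Ω → V) : Prop :=
  ∃ (p : Seminorm ℝ V) (S : ProbabilityMeasure V), IsRegularlyVaryingWith P p α X S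

/-- (Strict) stationarity of a process indexed by `ℤ`: the law of the whole path, on the product
σ-algebra, is invariant under all time shifts. -/
def IsStationary {Ω V : Type*} [MeasurableSpace Ω] [MeasurableSpace V]
    (P : Measure Ω) (Z : ℤ → Ω → V) : Prop :=
  ∀ h : ℤ, IdentDistrib (fun ω (t : ℤ) => Z (t + h) ω) (fun ω (t : ℤ) => Z t ω) P P

/-- The process `X` is stationary and jointly regularly varying of index `α`: for every `k ≥ 1`,
the random vector `(X 1, …, X k)` is regularly varying of index `α`. -/
def IsJointlyRegularlyVarying {Ω E : Type*} [MeasurableSpace Ω]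
    [NormedAddCommGroup E] [NormedSpace ℝ E] [FiniteDimensional ℝ E]
    [MeasurableSpace E] [BorelSpace E]
    (P : Measure Ω) [IsProbabilityMeasure P] (α : ℝ) (X : ℤ → Ω → E) : Prop :=
  IsStationary P X ∧
    ∀ k : ℕ, 1 ≤ k →
      IsRegularlyVarying P α (fun ω (j : Fin k) => X ((j : ℤ) + 1) ω)

/-- The moving average `X_t = ∑_{i=0}^m C_i(t) ξ_{t-i}`. The finite-dimensional normed spaces `E`
and `F` are `ℝ^d` and `ℝ^q` with arbitrary norms; a `d × q` matrix is a (continuous) linear map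
`F → E` and carries the corresponding operator norm and
its Borel σ-algebra. -/
def movingAverage {Ω E F : Type*}
    [NormedAddCommGroup E] [NormedSpace ℝ E] [NormedAddCommGroup F] [NormedSpace ℝ F]
    {m : ℕ} (C : Fin (m + 1) → ℤ → Ω → (F →L[ℝ] E)) (ξ : ℤ → Ω → F) (t : ℤ) (ω : Ω) : E :=
  ∑ i : Fin (m + 1), C i t ω (ξ (t - (i : ℤ)) ω)

/-- The coefficient array with the convention `C_j(·) = 0` if `j < 0` or `j > m`. -/
def coeff {Ω E F : Type*}
    [NormedAddCommGroup E] [NormedSpace ℝ E] [NormedAddCommGroup F] [NormedSpace ℝ F]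
    {m : ℕ} (C : Fin (m + 1) → ℤ → Ω → (F →L[ℝ] E)) (j t : ℤ) (ω : Ω) : F →L[ℝ] E :=
  if h : 0 ≤ j ∧ j ≤ m then C ⟨j.toNat, by omega⟩ t ω else 0

/-- The constant `c = ∑_{i=0}^m E ‖C_i(0) Θ‖ ^ α`, where `Θ` has law `S` and is independent of the
coefficients: on the product space `Ω × F` with measure `P ⊗ S`, the coefficients are functions of
the first coordinate and `Θ` is the second coordinate. -/
def tailConstant {Ω E F : Type*} [MeasurableSpace Ω]
    [NormedAddCommGroup E] [NormedSpace ℝ E]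
    [NormedAddCommGroup F] [NormedSpace ℝ F] [MeasurableSpace F]
    (P : Measure Ω) (S : ProbabilityMeasure F) (α : ℝ)
    {m : ℕ} (C : Fin (m + 1) → ℤ → Ω → (F →L[ℝ] E)) : ℝ :=
  ∑ i : Fin (m + 1), ∫ z : Ω × F, ‖C i 0 z.1 z.2‖ ^ α ∂(P.prod (S : Measure F))

end

end MMA

/-! The principle is that of the single big jump. Finitely many values of the moving average form a
linear image of one vector `(ξ_j)`, `j` in a finite window `J`, with random coefficients independent
of it. So everything follows from the asymptotics of a linear image of an i.i.d. regularly varying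
vector.

Regular variation says that the law of `ξ_0 / x`, divided by `P(‖ξ_0‖ > x)`, converges to a tail
measure on bounded continuous functions vanishing near the origin (`RegVarLaw.tendsto_integral`).
For the i.i.d. vector, two coordinates of order `x` cost the square of a tail, which is negligible.
The limit therefore lives on the coordinate axes, with one copy of the tail measure on each
(`RegVarLaw.tendsto_integral_pi`).

For a deterministic linear map `T`, the polar decomposition of the tail measure along the gauge `z ↦
‖T (Pi.single j z)‖` turns axis `j` into an expectation over `Θ` with weight `‖T (Pi.single j Θ)‖ ^
α`. The discontinuous event `‖T w‖ > x` is squeezed between continuous ramps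
(`RegVarLaw.tendsto_setIntegral_pi`).

Random coefficients are frozen by independence and then integrated. A Potter bound and the moment of
order `β > α` supply the dominating function (`RegVarLaw.tendsto_integral_exceed`).

In `tendsto_setIntegral_movingAverage` the times that are observed and the times whose norm must
exceed `x` are chosen separately. Conditioning on time `0` gives the tail ratio and the conditional
limit; using the times `1, …, k` in both roles gives joint regular variation. Stationarity holds
because the path is a shift-equivariant functional of two independent stationary inputs. -/

namespace MMA

/-- The tail function `x ↦ μ(‖z‖ > x)` of a law on a normed space. -/
noncomputable def tail {F : Type*} [NormedAddCommGroup F] [MeasurableSpace F] (μ : Measure F)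
    (x : ℝ) : ℝ :=
  μ.real {z | x < ‖z‖}

/-- Regular variation of a law `μ`, in terms of integrals of test functions. -/
def RegVarLaw {F : Type*} [NormedAddCommGroup F] [NormedSpace ℝ F] [MeasurableSpace F]
    (μ S : Measure F) (α : ℝ) : Prop :=
  ∀ u : ℝ, 0 < u → ∀ g : F →ᵇ ℝ,
    Tendsto (fun x : ℝ => (∫ z in {z | u * x < ‖z‖}, g (‖z‖⁻¹ • z) ∂μ) / tail μ x) atTop
      (𝓝 (u ^ (-α) * ∫ z, g z ∂S))

/-- The approximant and its limit may both change with the tolerance, so truncation levels can be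
fixed before the limit is taken. -/
lemma tendsto_of_forall_approx {ι : Type*} {l : Filter ι} {f : ι → ℝ} {a : ℝ}
    (h : ∀ κ > 0, ∃ (g : ι → ℝ) (b : ℝ), Tendsto g l (𝓝 b) ∧ |b - a| ≤ κ ∧
      ∀ᶠ i in l, |f i - g i| ≤ κ) :
    Tendsto f l (𝓝 a) := by
  rw [Metric.tendsto_nhds]
  intro κ hκ
  obtain ⟨g, b, hg, hb, hfg⟩ := h (κ / 4) (by positivity)
  filter_upwards [Metric.tendsto_nhds.1 hg (κ / 4) (by positivity), hfg] with i h1 h2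
  rw [Real.dist_eq] at h1 ⊢
  rw [abs_lt] at h1 ⊢
  rw [abs_le] at h2 hb
  constructor <;> linarith

/-! ### Tails of a regularly varying law and the Potter bound -/

section Tail

variable {F : Type*} [NormedAddCommGroup F] [MeasurableSpace F] {μ S : Measure F} {α : ℝ}

lemma tail_nonneg (x : ℝ) : 0 ≤ tail μ x := measureReal_nonneg

lemma RegVarLaw.tendsto_tail [NormedSpace ℝ F] [IsProbabilityMeasure S] (h : RegVarLaw μ S α) {u : ℝ} (hu : 0 < u) :
    Tendsto (fun x => tail μ (u * x) / tail μ x) atTop (𝓝 (u ^ (-α))) := by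
  simpa [tail] using h u hu (BoundedContinuousFunction.const F 1)

variable [IsProbabilityMeasure μ]

lemma tail_antitone : Antitone (tail μ) := fun _ _ hxy =>
  measureReal_mono fun _ hz => lt_of_le_of_lt hxy hz

lemma tail_le_one (x : ℝ) : tail μ x ≤ 1 := measureReal_le_one

lemma tendsto_tail_atTop [BorelSpace F] : Tendsto (tail μ) atTop (𝓝 0) := by
  have h : Tendsto (fun x : ℝ => μ {z | x < ‖z‖}) atTop (𝓝 (μ (⋂ x : ℝ, {z : F | x < ‖z‖}))) := by
    refine tendsto_measure_iInter_atTop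
      (fun x => (measurableSet_lt measurable_const measurable_norm).nullMeasurableSet)
      (fun _ _ hxy _ hz => lt_of_le_of_lt hxy hz) ⟨0, measure_ne_top _ _⟩
  have h0 : (⋂ x : ℝ, {z : F | x < ‖z‖}) = ∅ := by
    ext z
    simp only [Set.mem_iInter, Set.mem_ofPred_eq, Set.mem_empty_iff_false, iff_false, not_forall,
      not_lt]
    exact ⟨‖z‖, le_rfl⟩
  rw [h0, measure_empty] at h
  exact (ENNReal.tendsto_toReal ENNReal.zero_ne_top).comp h

variable [NormedSpace ℝ F] [IsProbabilityMeasure S]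

/-- A tail that vanishes once vanishes from there on. Its ratios are then `0 / 0 = 0`, against the
limit `1` that regular variation gives at `u = 1`. -/
lemma RegVarLaw.tail_pos (h : RegVarLaw μ S α) (x : ℝ) : 0 < tail μ x := by
  refine (tail_nonneg x).lt_of_ne fun h0 => ?_
  have h1 := h.tendsto_tail one_pos
  have h2 : (fun y => tail μ (1 * y) / tail μ y) =ᶠ[atTop] fun _ => 0 := by
    filter_upwards [eventually_ge_atTop x] with y hy
    have : tail μ y = 0 := le_antisymm ((tail_antitone hy).trans h0.symm.le) (tail_nonneg y)
    simp [this]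
  have := tendsto_nhds_unique h1 (tendsto_const_nhds.congr' h2.symm)
  simp at this

/-- A Potter bound. -/
lemma RegVarLaw.exists_tail_div_le (h : RegVarLaw μ S α) {β : ℝ} (hβ : α < β) (hβ0 : 0 < β) :
    ∃ K x₀ : ℝ, 0 < K ∧ 0 < x₀ ∧ ∀ x ≥ x₀, ∀ c > 0,
      tail μ (x / c) ≤ K * (1 + c ^ β) * tail μ x := by
  -- Halving the threshold multiplies the tail by `2 ^ α` in the limit, hence by less than `2 ^ β`
  -- far out.
  have h1 : ∀ᶠ x in atTop, tail μ ((1 / 2) * x) / tail μ x < 2 ^ β := by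
    refine (h.tendsto_tail (u := 1 / 2) (by norm_num)).eventually (gt_mem_nhds ?_)
    rw [one_div, Real.inv_rpow (by norm_num), ← Real.rpow_neg (by norm_num), neg_neg]
    exact Real.rpow_lt_rpow_of_exponent_lt (by norm_num) hβ
  obtain ⟨x₁, hx₁⟩ := eventually_atTop.1 h1
  set x₀ := max x₁ 1 with hx₀
  have hx0 : 0 < x₀ := lt_of_lt_of_le one_pos (le_max_right _ _)
  have step : ∀ x ≥ x₀, tail μ (x / 2) ≤ 2 ^ β * tail μ x := by
    intro x hx
    have := (hx₁ x ((le_max_left _ _).trans hx)).le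
    rwa [div_le_iff₀ (h.tail_pos x), one_div, inv_mul_eq_div] at this
  -- Repeated halving may leave the range `x ≥ x₀`. With this `K`, `K * tail μ x ≥ 1` for `x ≤ 2 *
  -- x₀`, so there the trivial bound by `1` suffices.
  set K := (tail μ (2 * x₀))⁻¹ with hK
  have hKpos : 0 < K := inv_pos.2 (h.tail_pos _)
  have hK1 : 1 ≤ K := (one_le_inv₀ (h.tail_pos _)).2 (tail_le_one _)
  have hiter : ∀ n : ℕ, ∀ x ≥ x₀, tail μ (x / 2 ^ n) ≤ K * (2 ^ β) ^ n * tail μ x := by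
    intro n
    induction n with
    | zero => intro x _; simpa using le_mul_of_one_le_left (tail_nonneg x) hK1
    | succ n ih =>
      intro x hx
      rcases le_total (2 * x₀) x with h2 | h2
      · have e : x / 2 ^ (n + 1) = (x / 2) / 2 ^ n := by rw [pow_succ']; field_simp
        rw [e]
        calc _ ≤ K * (2 ^ β) ^ n * tail μ (x / 2) := ih (x / 2) (by linarith)
          _ ≤ K * (2 ^ β) ^ n * (2 ^ β * tail μ x) := by gcongr; exact step x hx
          _ = _ := by ring
      · have e1 : 1 ≤ K * tail μ x := by
          rw [hK, inv_mul_eq_div, one_le_div (h.tail_pos _)]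
          exact tail_antitone h2
        have e2 : (1 : ℝ) ≤ (2 ^ β) ^ (n + 1) :=
          one_le_pow₀ (Real.one_le_rpow (by norm_num) hβ0.le)
        calc tail μ (x / 2 ^ (n + 1)) ≤ 1 := tail_le_one _
          _ ≤ (2 ^ β) ^ (n + 1) * (K * tail μ x) := one_le_mul_of_one_le_of_one_le e2 e1
          _ = _ := by ring
  -- The extra `2 ^ β` pays for rounding `c` up to a power of two: `2 ^ n ≤ c < 2 ^ (n + 1)`.
  refine ⟨K * 2 ^ β, x₀, by positivity, hx0, fun x hx c hc => ?_⟩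
  have hVx := tail_nonneg (μ := μ) x
  have h2β : (1 : ℝ) ≤ 2 ^ β := Real.one_le_rpow (by norm_num) hβ0.le
  rcases le_total c 1 with hc1 | hc1
  · calc tail μ (x / c) ≤ tail μ x := tail_antitone (le_div_self (hx0.le.trans hx) hc hc1)
      _ ≤ K * 2 ^ β * (1 + c ^ β) * tail μ x := by
        refine le_mul_of_one_le_left hVx ?_
        have : 0 ≤ c ^ β := by positivity
        exact one_le_mul_of_one_le_of_one_le (one_le_mul_of_one_le_of_one_le hK1 h2β)
          (by linarith)
  · obtain ⟨n, hn1, hn2⟩ := exists_nat_pow_near hc1 (one_lt_two)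
    calc tail μ (x / c) ≤ tail μ (x / 2 ^ (n + 1)) :=
          tail_antitone (div_le_div_of_nonneg_left (hx0.le.trans hx) hc hn2.le)
      _ ≤ K * (2 ^ β) ^ (n + 1) * tail μ x := hiter _ x hx
      _ = K * 2 ^ β * ((2 ^ n : ℝ) ^ β) * tail μ x := by
        rw [pow_succ, ← Real.rpow_natCast (2 ^ β), ← Real.rpow_mul (by norm_num),
          ← Real.rpow_natCast 2 n, ← Real.rpow_mul (by norm_num), mul_comm β]
        ring
      _ ≤ K * 2 ^ β * (1 + c ^ β) * tail μ x := by
        gcongr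
        have : (2 ^ n : ℝ) ^ β ≤ c ^ β := Real.rpow_le_rpow (by positivity) hn1 hβ0.le
        linarith

end Tail

/-! ### The tail measure and its polar decomposition -/

/-- The measure on `(0, ∞)` with `(u, ∞) ↦ u ^ (-α)`. -/
noncomputable def powerMeasure (α : ℝ) : Measure ℝ :=
  (volume.restrict (Set.Ioi (0 : ℝ))).map fun s => s ^ (-α⁻¹)

instance (α : ℝ) : SFinite (powerMeasure α) := by
  unfold powerMeasure; infer_instance

/-- The map `s ↦ s ^ (-α⁻¹)` is decreasing on `(0, ∞)`, so the preimage of `(u, ∞)` there is the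
interval `(0, u ^ (-α))`. -/
lemma powerMeasure_Ioi {α : ℝ} (hα : 0 < α) {u : ℝ} (hu : 0 < u) :
    powerMeasure α (Set.Ioi u) = ENNReal.ofReal (u ^ (-α)) := by
  have hm : Measurable fun s : ℝ => s ^ (-α⁻¹) := by fun_prop
  rw [powerMeasure, Measure.map_apply hm measurableSet_Ioi,
    Measure.restrict_apply (hm measurableSet_Ioi)]
  have : (fun s : ℝ => s ^ (-α⁻¹)) ⁻¹' Set.Ioi u ∩ Set.Ioi 0 = Set.Ioo 0 (u ^ (-α)) := by
    ext s
    simp only [Set.mem_inter_iff, Set.mem_preimage, Set.mem_Ioi, Set.mem_Ioo]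
    rw [and_comm]
    refine and_congr_right fun hs => ?_
    have e : u = (u ^ (-α)) ^ (-α⁻¹) := by
      rw [← Real.rpow_mul hu.le, neg_mul_neg, mul_inv_cancel₀ hα.ne', Real.rpow_one]
    conv_lhs => rw [e]
    exact Real.rpow_lt_rpow_iff_of_neg (by positivity) hs (by simpa using hα)
  rw [this, Real.volume_Ioo, sub_zero]

lemma ae_pos_powerMeasure (α : ℝ) : ∀ᵐ r ∂(powerMeasure α), 0 < r := by
  have hm : Measurable fun s : ℝ => s ^ (-α⁻¹) := by fun_prop
  rw [powerMeasure, ae_map_iff hm.aemeasurable measurableSet_Ioi]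
  filter_upwards [ae_restrict_mem measurableSet_Ioi] with s hs
  exact Real.rpow_pos_of_pos hs _

section LimitMeasure

variable {F : Type*} [NormedAddCommGroup F] [NormedSpace ℝ F] [MeasurableSpace F]

/-- The tail measure of a regularly varying law with index `α` and spectral measure `S`. -/
noncomputable def limitMeasure (S : Measure F) (α : ℝ) : Measure F :=
  ((powerMeasure α).prod S).map fun q : ℝ × F => q.1 • q.2

/-- A nonnegative, positively homogeneous function that is measurable and dominated by the norm. -/
structure IsGauge (p : F → ℝ) : Prop where
  measurable : Measurable p
  nonneg : ∀ z, 0 ≤ p z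
  smul : ∀ r : ℝ, 0 < r → ∀ z, p (r • z) = r * p z
  bound : ∃ B, ∀ z, p z ≤ B * ‖z‖

variable [BorelSpace F]

lemma isGauge_norm : IsGauge (fun z : F => ‖z‖) where
  measurable := measurable_norm
  nonneg := norm_nonneg
  smul r hr z := by rw [norm_smul, Real.norm_of_nonneg hr.le]
  bound := ⟨1, fun z => by simp⟩

variable [FiniteDimensional ℝ F] {S : Measure F} [IsProbabilityMeasure S] {α : ℝ}

/-- On the unit sphere the gauge is at most `B'`, so `p (r • θ) > t` forces `r > t / B'`, a set of
finite radial mass. -/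
lemma limitMeasure_gauge_lt_top (hα : 0 < α) (hS : ∀ᵐ θ ∂S, ‖θ‖ = 1) {p : F → ℝ} (hp : IsGauge p)
    {t : ℝ} (ht : 0 < t) : limitMeasure S α {z | t < p z} < ∞ := by
  obtain ⟨B, hB⟩ := hp.bound
  have hms : MeasurableSet {z : F | t < p z} := measurableSet_lt measurable_const hp.measurable
  have hmm : Measurable fun q : ℝ × F => q.1 • q.2 := by fun_prop
  rw [limitMeasure, Measure.map_apply hmm hms]
  set B' := max B 1
  have hB' : 0 < B' := lt_of_lt_of_le one_pos (le_max_right _ _)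
  calc ((powerMeasure α).prod S) ((fun q : ℝ × F => q.1 • q.2) ⁻¹' {z | t < p z})
      ≤ ((powerMeasure α).prod S) (Set.Ioi (t / B') ×ˢ Set.univ) := by
        refine measure_mono_ae ?_
        have h1 : ∀ᵐ q ∂((powerMeasure α).prod S), 0 < q.1 :=
          Measure.quasiMeasurePreserving_fst.ae (ae_pos_powerMeasure α)
        have h2 : ∀ᵐ q ∂((powerMeasure α).prod S), ‖q.2‖ = 1 :=
          Measure.quasiMeasurePreserving_snd.ae hS
        filter_upwards [h1, h2] with q hq1 hq2 hq
        refine ⟨?_, trivial⟩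
        change t < p (q.1 • q.2) at hq
        rw [hp.smul _ hq1] at hq
        have h3 : p q.2 ≤ B' := by
          have := hB q.2
          rw [hq2, mul_one] at this
          exact this.trans (le_max_left _ _)
        rw [Set.mem_Ioi, div_lt_iff₀ hB']
        nlinarith
    _ < ∞ := by
        rw [Measure.prod_prod, powerMeasure_Ioi hα (by positivity), measure_univ, mul_one]
        exact ENNReal.ofReal_lt_top

/-- The polar decomposition of the tail measure, with respect to any gauge. -/
lemma setIntegral_limitMeasure (hα : 0 < α) (hS : ∀ᵐ θ ∂S, ‖θ‖ = 1) {p : F → ℝ} (hp : IsGauge p)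
    {g : F → ℝ} (hg : Measurable g) {M : ℝ} (hM : ∀ z, |g z| ≤ M) {t : ℝ} (ht : 0 < t) :
    ∫ z in {z | t < p z}, g ((p z)⁻¹ • z) ∂(limitMeasure S α) =
      t ^ (-α) * ∫ θ, g ((p θ)⁻¹ • θ) * p θ ^ α ∂S := by
  have hms : MeasurableSet {z : F | t < p z} := measurableSet_lt measurable_const hp.measurable
  have hmm : Measurable fun q : ℝ × F => q.1 • q.2 := by fun_prop
  have hpm := hp.measurable
  have hgm : Measurable fun z => g ((p z)⁻¹ • z) := hg.comp (by fun_prop)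
  rw [← integral_indicator hms]
  have hint : Integrable ({z | t < p z}.indicator fun z => g ((p z)⁻¹ • z))
      (limitMeasure S α) := by
    rw [integrable_indicator_iff hms]
    refine Measure.integrableOn_of_bounded (limitMeasure_gauge_lt_top hα hS hp ht).ne
      hgm.aestronglyMeasurable (M := M) ?_
    exact ae_of_all _ fun z => hM _
  have him : AEStronglyMeasurable ({z | t < p z}.indicator fun z => g ((p z)⁻¹ • z))
      (limitMeasure S α) := hint.aestronglyMeasurable
  unfold limitMeasure at hint him ⊢
  have hint2 : Integrable (fun q : ℝ × F =>
      {z | t < p z}.indicator (fun z => g ((p z)⁻¹ • z)) (q.1 • q.2)) ((powerMeasure α).prod S) :=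
    (integrable_map_measure him hmm.aemeasurable).1 hint
  rw [integral_map hmm.aemeasurable him, integral_prod_symm _ hint2, ← integral_const_mul]
  refine integral_congr_ae ?_
  filter_upwards [hS] with θ hθ
  -- A direction with `p θ = 0` contributes to neither side, as `0 ^ α = 0`. Otherwise the integrand
  -- is constant in `r` on `r > t / p θ` and zero below, and the radial mass there is `t ^ (-α) * p
  -- θ ^ α`.
  rcases (hp.nonneg θ).eq_or_lt with h0 | h0
  · rw [← h0, Real.zero_rpow hα.ne', mul_zero, mul_zero]
    refine integral_eq_zero_of_ae ?_
    filter_upwards [ae_pos_powerMeasure α] with r hr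
    simp [Set.indicator, hp.smul r hr, ← h0, ht.not_gt]
  · have e : (fun r : ℝ => {z | t < p z}.indicator (fun z => g ((p z)⁻¹ • z)) (r • θ))
        =ᵐ[powerMeasure α] (Set.Ioi (t / p θ)).indicator fun _ => g ((p θ)⁻¹ • θ) := by
      filter_upwards [ae_pos_powerMeasure α] with r hr
      have e2 : (r * p θ)⁻¹ • r • θ = (p θ)⁻¹ • θ := by
        rw [smul_smul]; congr 1; field_simp
      simp only [Set.indicator, Set.mem_ofPred_eq, Set.mem_Ioi, hp.smul r hr, e2, div_lt_iff₀ h0]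
    rw [integral_congr_ae e, integral_indicator measurableSet_Ioi, setIntegral_const,
      Measure.real, powerMeasure_Ioi hα (by positivity), ENNReal.toReal_ofReal (by positivity),
      Real.div_rpow ht.le h0.le, smul_eq_mul, Real.rpow_neg h0.le]
    field_simp

end LimitMeasure

/-! ### From angular convergence to test functions vanishing near the origin -/

lemma exists_modulus {W : Type*} [NormedAddCommGroup W] [ProperSpace W] {h : W → ℝ}
    (hc : Continuous h) (R : ℝ) {κ : ℝ} (hκ : 0 < κ) :
    ∃ δ > 0, ∀ z z' : W, ‖z‖ ≤ R → ‖z'‖ ≤ R → ‖z - z'‖ ≤ δ → |h z - h z'| ≤ κ := by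
  have := (isCompact_closedBall (0 : W) R).uniformContinuousOn_of_continuous hc.continuousOn
  obtain ⟨δ, hδ, hd⟩ := Metric.uniformContinuousOn_iff_le.1 this κ hκ
  refine ⟨δ, hδ, fun z z' hz hz' hzz => ?_⟩
  have := hd z (by simpa using hz) z' (by simpa using hz') (by simpa [dist_eq_norm] using hzz)
  simpa [Real.dist_eq] using this

lemma measurableSet_lt_norm {F : Type*} [NormedAddCommGroup F] [MeasurableSpace F] [BorelSpace F]
    (u : ℝ) : MeasurableSet {z : F | u < ‖z‖} :=
  measurableSet_lt measurable_const measurable_norm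

lemma integrable_indicator_of_bounded {F : Type*} [MeasurableSpace F] {m : Measure F} {A : Set F}
    (hA : MeasurableSet A) (hm : m A < ∞) {g : F → ℝ} (hg : Measurable g) {M : ℝ}
    (hM : ∀ z, |g z| ≤ M) : Integrable (A.indicator g) m := by
  rw [integrable_indicator_iff hA]
  exact Measure.integrableOn_of_bounded hm.ne hg.aestronglyMeasurable (ae_of_all _ hM)

lemma integrable_of_eq_zero_near_zero {F : Type*} [NormedAddCommGroup F] [MeasurableSpace F]
    [BorelSpace F] {m : Measure F} {ε : ℝ} (hm : m {z : F | ε < ‖z‖} < ∞)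
    {h : F → ℝ} (hh : Measurable h) {M : ℝ} (hM : ∀ z, |h z| ≤ M)
    (h0 : ∀ z, ‖z‖ ≤ ε → h z = 0) : Integrable h m := by
  have := integrable_indicator_of_bounded (measurableSet_lt_norm ε) hm hh hM
  refine this.congr (ae_of_all _ fun z => ?_)
  by_cases hz : ε < ‖z‖
  · simp [Set.indicator, hz]
  · simp [Set.indicator, hz, h0 z (not_lt.1 hz)]

section Polar

variable {F : Type*} [NormedAddCommGroup F] [NormedSpace ℝ F]

/-- The radial step function with levels `r 0, r 1, …, r N` that approximates `h`. -/
noncomputable def radialStep (h : F → ℝ) (r : ℕ → ℝ) (N : ℕ) (z : F) : ℝ :=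
  ∑ k ∈ Finset.range N,
    ({z : F | r k < ‖z‖}.indicator (fun z => h (r (k + 1) • (‖z‖⁻¹ • z))) z -
      {z : F | r (k + 1) < ‖z‖}.indicator (fun z => h (r (k + 1) • (‖z‖⁻¹ • z))) z)

/-- Each summand of the step function lives on one shell `r k < ‖z‖ ≤ r (k + 1)`, where `z` is
compared with its radial projection to the outer sphere. Inside `r 0` both functions vanish; beyond
`r N` only `h` remains. A shell is written as a difference of two complements of balls because
angular convergence is known on those. -/
lemma abs_sub_radialStep_le {h : F → ℝ} {r : ℕ → ℝ} (hr : StrictMono r) (h0 : 0 < r 0) {N : ℕ}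
    {κ M : ℝ} (hκ : 0 ≤ κ) (hM : ∀ z, |h z| ≤ M) (hz0 : ∀ z, ‖z‖ ≤ r 0 → h z = 0)
    (hclose : ∀ z z' : F, ‖z‖ ≤ r N → ‖z'‖ ≤ r N → (∃ k, r k < ‖z‖ ∧ ‖z‖ ≤ r (k + 1) ∧
      z' = r (k + 1) • (‖z‖⁻¹ • z)) → |h z - h z'| ≤ κ) (z : F) :
    |h z - radialStep h r N z| ≤
      {z : F | r 0 < ‖z‖}.indicator (fun _ => κ) z +
        {z : F | r N < ‖z‖}.indicator (fun _ => M) z := by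
  have hM0 : 0 ≤ M := (abs_nonneg _).trans (hM 0)
  by_cases hA : r 0 < ‖z‖
  · by_cases hB : r N < ‖z‖
    · have : radialStep h r N z = 0 := by
        refine Finset.sum_eq_zero fun k hk => ?_
        have h1 : r k < ‖z‖ :=
          lt_of_le_of_lt (hr.monotone (Finset.mem_range.1 hk).le) hB
        have h2 : r (k + 1) < ‖z‖ :=
          lt_of_le_of_lt (hr.monotone (Finset.mem_range.1 hk)) hB
        simp [Set.indicator, h1, h2]
      simp only [this, sub_zero, Set.indicator, Set.mem_ofPred_eq, hA, hB, if_true]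
      linarith [hM z]
    · push Not at hB
      have hex : ∃ k, ‖z‖ ≤ r k := ⟨N, hB⟩
      classical
      obtain ⟨k, hk⟩ : ∃ k, Nat.find hex = k + 1 := by
        refine Nat.exists_eq_succ_of_ne_zero fun h => ?_
        have := Nat.find_spec hex
        rw [h] at this
        linarith
      have hk1 : ‖z‖ ≤ r (k + 1) := hk ▸ Nat.find_spec hex
      have hk2 : r k < ‖z‖ := not_le.1 (Nat.find_min hex (by omega))
      have hkN : k < N := by
        have := Nat.find_min' hex hB
        omega
      have hst : radialStep h r N z = h (r (k + 1) • (‖z‖⁻¹ • z)) := by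
        rw [radialStep, Finset.sum_eq_single k]
        · simp [Set.indicator, hk2, hk1.not_gt]
        · intro j _ hj
          rcases lt_or_gt_of_ne hj with hj | hj
          · have h1 : r j < ‖z‖ := (hr hj).trans hk2
            have h2 : r (j + 1) < ‖z‖ := (hr.monotone hj).trans_lt hk2
            simp [Set.indicator, h1, h2]
          · have h1 : ¬ r j < ‖z‖ := (hk1.trans (hr.monotone hj)).not_gt
            have h2 : ¬ r (j + 1) < ‖z‖ := (hk1.trans (hr.monotone (by omega))).not_gt
            simp [Set.indicator, h1, h2]
        · intro h; exact absurd (Finset.mem_range.2 hkN) h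
      have hpos : 0 < ‖z‖ := h0.trans hA
      have hn : ‖r (k + 1) • (‖z‖⁻¹ • z)‖ = r (k + 1) := by
        rw [norm_smul, norm_smul, norm_inv, norm_norm, inv_mul_cancel₀ hpos.ne', mul_one,
          Real.norm_of_nonneg (hpos.le.trans hk1)]
      have := hclose z _ hB (hn.le.trans (hr.monotone hkN)) ⟨k, hk2, hk1, rfl⟩
      simpa [hst, Set.indicator, hA, hB.not_gt] using this
  · have : radialStep h r N z = 0 := by
      refine Finset.sum_eq_zero fun k _ => ?_
      have h1 : ¬ r k < ‖z‖ := ((not_lt.1 hA).trans (hr.monotone (Nat.zero_le _))).not_gt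
      have h2 : ¬ r (k + 1) < ‖z‖ := ((not_lt.1 hA).trans (hr.monotone (Nat.zero_le _))).not_gt
      simp [Set.indicator, h1, h2]
    rw [this, hz0 z (not_lt.1 hA)]
    simp only [sub_zero, abs_zero]
    exact add_nonneg (Set.indicator_nonneg (fun _ _ => hκ) _)
      (Set.indicator_nonneg (fun _ _ => hM0) _)

variable [MeasurableSpace F] [BorelSpace F] [FiniteDimensional ℝ F]

lemma measurable_comp_sphere {h : F → ℝ} (hh : Measurable h) (c : ℝ) :
    Measurable fun z : F => h (c • (‖z‖⁻¹ • z)) :=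
  hh.comp (by fun_prop)

lemma integrable_radialStep {m : Measure F} {h : F → ℝ} {r : ℕ → ℝ} {N : ℕ} {M : ℝ}
    (hfin : ∀ k, m {z : F | r k < ‖z‖} < ∞) (hh : Measurable h) (hM : ∀ z, |h z| ≤ M) :
    Integrable (radialStep h r N) m := by
  unfold radialStep
  refine integrable_finsetSum _ fun k _ => Integrable.sub ?_ ?_ <;>
    exact integrable_indicator_of_bounded (measurableSet_lt_norm _) (hfin _)
      (measurable_comp_sphere hh _) fun z => hM _

lemma integral_radialStep {m : Measure F} {h : F → ℝ} {r : ℕ → ℝ} {N : ℕ} {M : ℝ}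
    (hfin : ∀ k, m {z : F | r k < ‖z‖} < ∞) (hh : Measurable h) (hM : ∀ z, |h z| ≤ M) :
    ∫ z, radialStep h r N z ∂m = ∑ k ∈ Finset.range N,
      (∫ z in {z | r k < ‖z‖}, h (r (k + 1) • (‖z‖⁻¹ • z)) ∂m -
        ∫ z in {z | r (k + 1) < ‖z‖}, h (r (k + 1) • (‖z‖⁻¹ • z)) ∂m) := by
  have hi : ∀ k c, Integrable
      ({z : F | r k < ‖z‖}.indicator (fun z => h (c • (‖z‖⁻¹ • z)))) m := fun k c =>
    integrable_indicator_of_bounded (measurableSet_lt_norm _) (hfin _)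
      (measurable_comp_sphere hh _) fun z => hM _
  unfold radialStep
  rw [integral_finsetSum]
  swap
  · exact fun k _ => (hi k _).sub (hi (k + 1) _)
  refine Finset.sum_congr rfl fun k _ => ?_
  rw [integral_sub (hi k _) (hi (k + 1) _), integral_indicator (measurableSet_lt_norm _),
    integral_indicator (measurableSet_lt_norm _)]

lemma abs_integral_sub_radialStep_le {m : Measure F} {h : F → ℝ} {r : ℕ → ℝ} (hr : StrictMono r)
    (h0 : 0 < r 0) {N : ℕ} {κ M : ℝ} (hκ : 0 ≤ κ) (hM : ∀ z, |h z| ≤ M)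
    (hz0 : ∀ z, ‖z‖ ≤ r 0 → h z = 0)
    (hclose : ∀ z z' : F, ‖z‖ ≤ r N → ‖z'‖ ≤ r N → (∃ k, r k < ‖z‖ ∧ ‖z‖ ≤ r (k + 1) ∧
      z' = r (k + 1) • (‖z‖⁻¹ • z)) → |h z - h z'| ≤ κ)
    (hfin : ∀ k, m {z : F | r k < ‖z‖} < ∞) (hh : Measurable h) :
    |∫ z, h z ∂m - ∫ z, radialStep h r N z ∂m| ≤
      m.real {z : F | r 0 < ‖z‖} * κ + m.real {z : F | r N < ‖z‖} * M := by
  have hM0 : 0 ≤ M := (abs_nonneg _).trans (hM 0)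
  have i1 : Integrable h m := integrable_of_eq_zero_near_zero (hfin 0) hh hM hz0
  have i2 : Integrable (radialStep h r N) m := integrable_radialStep hfin hh hM
  have i3 : ∀ k, ∀ c : ℝ, Integrable ({z : F | r k < ‖z‖}.indicator fun _ => c) m := fun k c =>
    integrable_indicator_of_bounded (measurableSet_lt_norm _) (hfin _) measurable_const
      fun _ => le_rfl
  rw [← integral_sub i1 i2]
  calc |∫ z, (h z - radialStep h r N z) ∂m| ≤ ∫ z, |h z - radialStep h r N z| ∂m :=
        abs_integral_le_integral_abs
    _ ≤ ∫ z, ({z : F | r 0 < ‖z‖}.indicator (fun _ => κ) z +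
        {z : F | r N < ‖z‖}.indicator (fun _ => M) z) ∂m :=
        integral_mono (i1.sub i2).abs ((i3 0 κ).add (i3 N M))
          (abs_sub_radialStep_le hr h0 hκ hM hz0 hclose)
    _ = _ := by
        rw [integral_add (i3 0 κ) (i3 N M), integral_indicator (measurableSet_lt_norm _),
          integral_indicator (measurableSet_lt_norm _), setIntegral_const, setIntegral_const,
          smul_eq_mul, smul_eq_mul]

/-- Convergence of angular integrals over all complements of balls implies convergence of the
integrals of all bounded continuous functions that vanish near the origin. -/
lemma tendsto_integral_of_polar {ι : Type*} {l : Filter ι} {m : ι → Measure F} {m' : Measure F}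
    (hfin : ∀ i, ∀ u > 0, m i {z | u < ‖z‖} < ∞) (hfin' : ∀ u > 0, m' {z | u < ‖z‖} < ∞)
    (hconv : ∀ u > 0, ∀ g : F →ᵇ ℝ, Tendsto (fun i => ∫ z in {z | u < ‖z‖}, g (‖z‖⁻¹ • z) ∂(m i)) l
      (𝓝 (∫ z in {z | u < ‖z‖}, g (‖z‖⁻¹ • z) ∂m')))
    (hvan : Tendsto (fun R : ℝ => m'.real {z | R < ‖z‖}) atTop (𝓝 0))
    (h : F →ᵇ ℝ) {ε : ℝ} (hε : 0 < ε) (h0 : ∀ z, ‖z‖ ≤ ε → h z = 0) :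
    Tendsto (fun i => ∫ z, h z ∂(m i)) l (𝓝 (∫ z, h z ∂m')) := by
  have hmass : ∀ u > 0, Tendsto (fun i => (m i).real {z | u < ‖z‖}) l
      (𝓝 (m'.real {z | u < ‖z‖})) := fun u hu => by
    simpa using hconv u hu (BoundedContinuousFunction.const F 1)
  have hM : ∀ z, |h z| ≤ ‖h‖ := fun z => h.norm_coe_le_norm z
  have hM0 : 0 ≤ ‖h‖ := norm_nonneg h
  refine tendsto_of_forall_approx fun κ hκ => ?_
  set a := m'.real {z | ε < ‖z‖} with ha
  have ha0 : 0 ≤ a := measureReal_nonneg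
  -- `R` makes the limit mass far out small against `‖h‖`. Then `δ` is a modulus of continuity of
  -- `h` on the ball of radius `R`, and `N` makes the shells between `ε` and `R` thinner than `δ`.
  obtain ⟨R, hRm, hRε⟩ := ((hvan.eventually (gt_mem_nhds
    (show (0 : ℝ) < κ / (4 * (‖h‖ + 1)) by positivity))).and (eventually_gt_atTop ε)).exists
  obtain ⟨δ, hδ, hmod⟩ := exists_modulus h.continuous R
    (show (0 : ℝ) < κ / (4 * (a + 1)) by positivity)
  obtain ⟨N, hN⟩ := exists_nat_gt ((R - ε) / δ)
  have hRε' : 0 < R - ε := sub_pos.2 hRε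
  have hN0 : (0 : ℝ) < N := lt_trans (by positivity) hN
  set d := (R - ε) / N with hd
  have hd0 : 0 < d := by positivity
  have hdδ : d ≤ δ := by
    rw [hd, div_le_iff₀ hN0]
    rw [div_lt_iff₀ hδ] at hN
    linarith
  set r : ℕ → ℝ := fun k => ε + k * d with hr
  have hrm : StrictMono r := strictMono_nat_of_lt_succ fun k => by
    simp only [hr]; push_cast; linarith
  have hr0 : r 0 = ε := by simp [hr]
  have hrN : r N = R := by simp only [hr, hd]; field_simp; ring
  have hrpos : ∀ k, 0 < r k := fun k => by positivity
  have hclose : ∀ z z' : F, ‖z‖ ≤ r N → ‖z'‖ ≤ r N → (∃ k, r k < ‖z‖ ∧ ‖z‖ ≤ r (k + 1) ∧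
      z' = r (k + 1) • (‖z‖⁻¹ • z)) → |h z - h z'| ≤ κ / (4 * (a + 1)) := by
    rintro z z' hz hz' ⟨k, hk1, hk2, rfl⟩
    rw [hrN] at hz hz'
    refine hmod z _ hz hz' (le_trans ?_ hdδ)
    have hzpos : 0 < ‖z‖ := (hrpos k).trans hk1
    have e : z - r (k + 1) • (‖z‖⁻¹ • z) = (‖z‖ - r (k + 1)) • (‖z‖⁻¹ • z) := by
      rw [sub_smul, smul_smul ‖z‖, mul_inv_cancel₀ hzpos.ne', one_smul]
    rw [e, norm_smul, norm_smul, norm_inv, norm_norm, inv_mul_cancel₀ hzpos.ne', mul_one,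
      Real.norm_eq_abs, abs_le]
    have : r (k + 1) = r k + d := by simp only [hr]; push_cast; ring
    constructor <;> linarith
  have hh : Measurable h := h.continuous.measurable
  have key : ∀ n : Measure F, (∀ u > 0, n {z | u < ‖z‖} < ∞) →
      |∫ z, h z ∂n - ∫ z, radialStep h r N z ∂n| ≤
        n.real {z | ε < ‖z‖} * (κ / (4 * (a + 1))) + n.real {z | R < ‖z‖} * ‖h‖ := by
    intro n hn
    have := abs_integral_sub_radialStep_le (m := n) hrm (hrpos 0) (N := N) (by positivity) hM
      (fun z hz => h0 z (hr0 ▸ hz)) hclose (fun k => hn _ (hrpos k)) hh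
    rwa [hr0, hrN] at this
  -- The bound tolerates mass `a + 1` outside radius `ε` and twice the outer mass allowed for `m'`.
  -- This slack lets it hold eventually for `m i` too.
  have hbound : ∀ b c : ℝ, b ≤ a + 1 → 0 ≤ c → c ≤ κ / (2 * (‖h‖ + 1)) →
      b * (κ / (4 * (a + 1))) + c * ‖h‖ ≤ κ := by
    intro b c hb hc0 hc
    have e1 : b * (κ / (4 * (a + 1))) ≤ (a + 1) * (κ / (4 * (a + 1))) := by gcongr
    have e2 : c * ‖h‖ ≤ κ / (2 * (‖h‖ + 1)) * (‖h‖ + 1) := by gcongr; linarith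
    have e3 : (a + 1) * (κ / (4 * (a + 1))) = κ / 4 := by field_simp
    have e4 : κ / (2 * (‖h‖ + 1)) * (‖h‖ + 1) = κ / 2 := by field_simp
    linarith
  have hlt : κ / (4 * (‖h‖ + 1)) < κ / (2 * (‖h‖ + 1)) := by gcongr; norm_num
  refine ⟨fun i => ∫ z, radialStep h r N z ∂(m i), ∫ z, radialStep h r N z ∂m', ?_, ?_, ?_⟩
  · simp_rw [fun i => integral_radialStep (m := m i) (N := N) (fun k => hfin i _ (hrpos k)) hh hM,
      integral_radialStep (m := m') (N := N) (fun k => hfin' _ (hrpos k)) hh hM]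
    refine tendsto_finsetSum _ fun k _ => Tendsto.sub ?_ ?_
    -- Each shell integral is an angular integral of the test function `z ↦ h (r (k + 1) • z)`.
    · exact hconv _ (hrpos _) (h.compContinuous ⟨fun z => r (k + 1) • z, by fun_prop⟩)
    · exact hconv _ (hrpos _) (h.compContinuous ⟨fun z => r (k + 1) • z, by fun_prop⟩)
  · rw [abs_sub_comm]
    exact (key m' hfin').trans (hbound _ _ (by linarith) measureReal_nonneg (hRm.le.trans hlt.le))
  · filter_upwards [(hmass ε hε).eventually (gt_mem_nhds (show a < a + 1 by linarith)),
      (hmass R (hε.trans hRε)).eventually (gt_mem_nhds (hRm.trans hlt))] with i h1 h2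
    exact (key (m i) (hfin i)).trans (hbound _ _ h1.le measureReal_nonneg h2.le)

variable {μ S : Measure F} [IsProbabilityMeasure μ] [IsProbabilityMeasure S] {α : ℝ}

lemma measureReal_limitMeasure (hα : 0 < α) (hS : ∀ᵐ θ ∂S, ‖θ‖ = 1) {u : ℝ} (hu : 0 < u) :
    (limitMeasure S α).real {z | u < ‖z‖} = u ^ (-α) := by
  have := setIntegral_limitMeasure (S := S) hα hS isGauge_norm (g := fun _ => 1)
    measurable_const (M := 1) (by simp) hu
  have h1 : ∫ θ, ‖θ‖ ^ α ∂S = 1 := by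
    rw [integral_congr_ae (g := fun _ => 1) (by filter_upwards [hS] with θ hθ; simp [hθ])]
    simp
  simpa [h1] using this

/-- A regularly varying law converges vaguely, after scaling, to its tail measure. -/
lemma RegVarLaw.tendsto_integral (h : RegVarLaw μ S α) (hα : 0 < α) (hS : ∀ᵐ θ ∂S, ‖θ‖ = 1)
    (f : F →ᵇ ℝ) {ε : ℝ} (hε : 0 < ε) (h0 : ∀ z, ‖z‖ ≤ ε → f z = 0) :
    Tendsto (fun x : ℝ => (∫ z, f (x⁻¹ • z) ∂μ) / tail μ x) atTop
      (𝓝 (∫ z, f z ∂(limitMeasure S α))) := by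
  have hsm : ∀ x : ℝ, Measurable fun z : F => x⁻¹ • z := fun x => measurable_const_smul _
  let m : ℝ → Measure F := fun x => ENNReal.ofReal (tail μ x)⁻¹ • μ.map fun z => x⁻¹ • z
  have hm : ∀ x (g : F → ℝ), Measurable g →
      ∫ z, g z ∂(m x) = (∫ z, g (x⁻¹ • z) ∂μ) / tail μ x := by
    intro x g hg
    rw [integral_smul_measure, integral_map (hsm x).aemeasurable hg.aestronglyMeasurable,
      ENNReal.toReal_ofReal (inv_nonneg.2 (tail_nonneg x)), smul_eq_mul, inv_mul_eq_div]
  have key := tendsto_integral_of_polar (l := atTop) (m := m) (m' := limitMeasure S α) ?_ ?_ ?_ ?_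
    f hε h0
  · simpa only [hm _ f f.continuous.measurable] using key
  · intro x u _
    have : IsFiniteMeasure (μ.map fun z => x⁻¹ • z) := inferInstance
    exact ENNReal.mul_lt_top ENNReal.ofReal_lt_top (measure_lt_top _ _)
  · intro u hu
    exact limitMeasure_gauge_lt_top hα hS isGauge_norm hu
  · intro u hu g
    rw [setIntegral_limitMeasure hα hS isGauge_norm g.continuous.measurable
      (fun z => g.norm_coe_le_norm z) hu]
    have e : ∫ θ, g (‖θ‖⁻¹ • θ) * ‖θ‖ ^ α ∂S = ∫ θ, g θ ∂S :=
      integral_congr_ae (by filter_upwards [hS] with θ hθ; simp [hθ])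
    rw [e]
    refine (h u hu g).congr' ?_
    filter_upwards [eventually_gt_atTop 0] with x hx
    rw [← integral_indicator (measurableSet_lt_norm u), hm,
      ← integral_indicator (measurableSet_lt_norm _)]
    · congr 2
      ext z
      have e1 : u < x⁻¹ * ‖z‖ ↔ u * x < ‖z‖ := by rw [inv_mul_eq_div, lt_div_iff₀ hx]
      have e2 : (x⁻¹ * ‖z‖)⁻¹ • x⁻¹ • z = ‖z‖⁻¹ • z := by
        rw [smul_smul]; congr 1; field_simp
      simp only [Set.indicator, Set.mem_ofPred_eq, norm_smul, norm_inv,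
        Real.norm_of_nonneg hx.le, e1, e2]
    · exact Measurable.indicator (g.continuous.measurable.comp (by fun_prop))
        (measurableSet_lt_norm u)
  · have : Tendsto (fun R : ℝ => R ^ (-α)) atTop (𝓝 0) := tendsto_rpow_neg_atTop hα
    refine this.congr' ?_
    filter_upwards [eventually_gt_atTop 0] with R hR
    rw [measureReal_limitMeasure hα hS hR]

end Polar

/-! ### The single big jump for independent vectors -/

section BigJump

variable {J F : Type*} [Fintype J] [DecidableEq J] [NormedAddCommGroup F]

/-- If no coordinate exceeds `ε`, all terms vanish. If one exceeds `ε` and another exceeds `δ`, the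
crude bound `(card J + 1) * M` is charged to that pair. If the others stay below `δ`, then `w` is
within `δ` of its projection to one axis, and the modulus applies unless the large coordinate
exceeds `R`. -/
lemma abs_sub_sum_single_le {f : (J → F) → ℝ} {M κ ε δ R : ℝ} (hM : ∀ w, |f w| ≤ M)
    (hκ : 0 ≤ κ) (hε : 0 ≤ ε) (hδ : 0 ≤ δ) (hδε : δ ≤ ε) (hεR : ε ≤ R)
    (h0 : ∀ w, ‖w‖ ≤ ε → f w = 0)
    (hmod : ∀ w w' : J → F, ‖w‖ ≤ R → ‖w'‖ ≤ R → ‖w - w'‖ ≤ δ → |f w - f w'| ≤ κ) (w : J → F) :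
    |f w - ∑ j, f (Pi.single j (w j))| ≤
      ∑ j, ({w : J → F | ε < ‖w j‖}.indicator (fun _ => κ) w +
        {w : J → F | R < ‖w j‖}.indicator (fun _ => 2 * M) w) +
      ∑ q ∈ Finset.univ.offDiag, {w : J → F | δ < ‖w q.1‖ ∧ δ < ‖w q.2‖}.indicator
        (fun _ => (Fintype.card J + 1) * M) w := by
  have hM0 : 0 ≤ M := (abs_nonneg _).trans (hM 0)
  have hc0 : (0 : ℝ) ≤ (Fintype.card J + 1) * M := by positivity
  have nn1 : ∀ j, 0 ≤ {w : J → F | ε < ‖w j‖}.indicator (fun _ => κ) w := fun j =>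
    Set.indicator_nonneg (fun _ _ => hκ) _
  have nn2 : ∀ j, 0 ≤ {w : J → F | R < ‖w j‖}.indicator (fun _ => 2 * M) w := fun j =>
    Set.indicator_nonneg (fun _ _ => by positivity) _
  have nn3 : ∀ q : J × J, 0 ≤ {w : J → F | δ < ‖w q.1‖ ∧ δ < ‖w q.2‖}.indicator
      (fun _ => (Fintype.card J + 1) * M) w := fun q =>
    Set.indicator_nonneg (fun _ _ => hc0) _
  have hs0 : ∀ j, ‖w j‖ ≤ ε → f (Pi.single j (w j)) = 0 := fun j hj =>
    h0 _ (by rwa [Pi.norm_single])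
  by_cases hA : ∀ j, ‖w j‖ ≤ ε
  · rw [h0 w ((pi_norm_le_iff_of_nonneg hε).2 hA), Finset.sum_eq_zero fun j _ => hs0 j (hA j)]
    simp only [sub_zero, abs_zero]
    exact add_nonneg (Finset.sum_nonneg fun j _ => add_nonneg (nn1 j) (nn2 j))
      (Finset.sum_nonneg fun q _ => nn3 q)
  push Not at hA
  obtain ⟨k, hk⟩ := hA
  have le1 := Finset.single_le_sum (fun j _ => add_nonneg (nn1 j) (nn2 j)) (Finset.mem_univ k)
  by_cases hB : ∃ j, j ≠ k ∧ δ < ‖w j‖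
  · obtain ⟨j, hjk, hj⟩ := hB
    have le2 := Finset.single_le_sum (fun q _ => nn3 q)
      (show (k, j) ∈ Finset.univ.offDiag by simpa using hjk.symm)
    have e : {w : J → F | δ < ‖w k‖ ∧ δ < ‖w j‖}.indicator
        (fun _ => (Fintype.card J + 1) * M) w = (Fintype.card J + 1) * M :=
      Set.indicator_of_mem (s := {w : J → F | δ < ‖w k‖ ∧ δ < ‖w j‖})
        ⟨hδε.trans_lt hk, hj⟩ _
    rw [e] at le2
    have h1 : |∑ j, f (Pi.single j (w j))| ≤ Fintype.card J * M := by
      refine (Finset.abs_sum_le_sum_abs _ _).trans ((Finset.sum_le_sum fun j _ => hM _).trans ?_)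
      simp
    have h2 := abs_sub (f w) (∑ j, f (Pi.single j (w j)))
    have h3 := hM w
    have h4 := add_nonneg (nn1 k) (nn2 k)
    linarith
  · push Not at hB
    have hsum : ∑ j, f (Pi.single j (w j)) = f (Pi.single k (w k)) :=
      Finset.sum_eq_single k (fun j _ hj => hs0 j ((hB j hj).trans hδε)) (by simp)
    rw [hsum]
    refine le_trans ?_ (le_add_of_le_of_nonneg le1 (Finset.sum_nonneg fun q _ => nn3 q))
    simp only [Set.indicator, Set.mem_ofPred_eq, hk, if_true]
    by_cases hR : R < ‖w k‖
    · have h2 := abs_sub (f w) (f (Pi.single k (w k)))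
      have h3 := hM w
      have h4 := hM (Pi.single k (w k))
      simp only [hR, if_true]
      linarith
    · simp only [hR, if_false, add_zero]
      have hR := not_lt.1 hR
      refine hmod _ _ ?_ (by rwa [Pi.norm_single]) ?_
      · refine (pi_norm_le_iff_of_nonneg (hε.trans hεR)).2 fun j => ?_
        rcases eq_or_ne j k with rfl | hj
        · exact hR
        · exact (hB j hj).trans (hδε.trans hεR)
      · refine (pi_norm_le_iff_of_nonneg hδ).2 fun j => ?_
        rcases eq_or_ne j k with rfl | hj
        · simpa using hδ
        · simpa [Pi.single_eq_of_ne hj] using hB j hj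

variable [MeasurableSpace F] [BorelSpace F] (μ : Measure F) [IsProbabilityMeasure μ]

omit [DecidableEq J] in
lemma measureReal_pi_coord (j : J) (t : ℝ) :
    (Measure.pi fun _ : J => μ).real {w | t < ‖w j‖} = tail μ t := by
  have := (measurePreserving_eval (fun _ : J => μ) j).measure_preimage
    (measurableSet_lt_norm t).nullMeasurableSet
  exact congrArg ENNReal.toReal this

omit [DecidableEq J] in
lemma measureReal_pi_coord_pair {i j : J} (hij : i ≠ j) (t : ℝ) :
    (Measure.pi fun _ : J => μ).real {w | t < ‖w i‖ ∧ t < ‖w j‖} = tail μ t ^ 2 := by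
  have hind : iIndepFun (fun (i : J) (w : J → F) => w i) (Measure.pi fun _ : J => μ) :=
    iIndepFun_pi (X := fun _ => id) fun _ => aemeasurable_id
  have := (hind.indepFun hij).measure_inter_preimage_eq_mul _ _
    (measurableSet_lt_norm t) (measurableSet_lt_norm t)
  have h2 := congrArg ENNReal.toReal this
  rw [ENNReal.toReal_mul] at h2
  change (Measure.pi fun _ : J => μ).real {w | t < ‖w i‖ ∧ t < ‖w j‖} =
    (Measure.pi fun _ : J => μ).real {w | t < ‖w i‖} *
      (Measure.pi fun _ : J => μ).real {w | t < ‖w j‖} at h2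
  rw [h2, measureReal_pi_coord, measureReal_pi_coord, sq]

variable [NormedSpace ℝ F] [FiniteDimensional ℝ F] {μ} {S : Measure F} [IsProbabilityMeasure S]
  {α : ℝ}

/-- The pointwise estimate is integrated at `x⁻¹ • w`. Independence makes the pair term quadratic in
the tail, hence negligible after division by `tail μ x`. -/
lemma abs_integral_pi_sub_le {f : (J → F) →ᵇ ℝ} {M κ ε δ R : ℝ} (hM : ∀ w, |f w| ≤ M)
    (hκ : 0 ≤ κ) (hε : 0 ≤ ε) (hδ : 0 ≤ δ) (hδε : δ ≤ ε) (hεR : ε ≤ R)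
    (h0 : ∀ w, ‖w‖ ≤ ε → f w = 0)
    (hmod : ∀ w w' : J → F, ‖w‖ ≤ R → ‖w'‖ ≤ R → ‖w - w'‖ ≤ δ → |f w - f w'| ≤ κ) {x : ℝ}
    (hx : 0 < x) :
    |∫ w, f (x⁻¹ • w) ∂(Measure.pi fun _ : J => μ) -
        ∑ j, ∫ z, f (Pi.single j (x⁻¹ • z)) ∂μ| ≤
      Fintype.card J * (tail μ (ε * x) * κ + tail μ (R * x) * (2 * M)) +
        (Fintype.card J) ^ 2 * (tail μ (δ * x) ^ 2 * ((Fintype.card J + 1) * M)) := by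
  have hM0 : 0 ≤ M := (abs_nonneg _).trans (hM 0)
  set Q := Measure.pi fun _ : J => μ with hQ
  have hsc : ∀ (t : ℝ) (j : J) (w : J → F), t < ‖x⁻¹ • w j‖ ↔ t * x < ‖w j‖ := fun t j w => by
    rw [norm_smul, norm_inv, Real.norm_of_nonneg hx.le, inv_mul_eq_div,
      lt_div_iff₀ hx]
  have ms : ∀ (t : ℝ) (j : J), MeasurableSet {w : J → F | t < ‖w j‖} := fun t j =>
    measurableSet_lt measurable_const (measurable_pi_apply j).norm
  have ms2 : ∀ (t : ℝ) (q : J × J), MeasurableSet {w : J → F | t < ‖w q.1‖ ∧ t < ‖w q.2‖} :=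
    fun t q => (ms t q.1).inter (ms t q.2)
  have ic : ∀ (A : Set (J → F)) (c : ℝ), MeasurableSet A →
      Integrable (A.indicator fun _ => c) Q := fun A c hA =>
    integrable_indicator_of_bounded hA (measure_lt_top _ _) measurable_const fun _ => le_rfl
  have vi : ∀ (A : Set (J → F)) (c : ℝ), MeasurableSet A →
      ∫ w, A.indicator (fun _ => c) w ∂Q = Q.real A * c := fun A c hA => by
    rw [integral_indicator hA, setIntegral_const, smul_eq_mul]
  have i1 : Integrable (fun w => f (x⁻¹ • w)) Q :=
    Integrable.of_bound (f.continuous.comp (by fun_prop)).aestronglyMeasurable M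
      (ae_of_all _ fun w => hM _)
  have hcs : ∀ j, Continuous fun z : F => f (Pi.single j (x⁻¹ • z)) := fun j =>
    f.continuous.comp ((continuous_single j).comp (by fun_prop))
  have i2 : ∀ j, Integrable (fun w : J → F => f (Pi.single j (x⁻¹ • w j))) Q := fun j =>
    Integrable.of_bound ((hcs j).comp (continuous_apply j)).aestronglyMeasurable M
      (ae_of_all _ fun w => hM _)
  have e2 : ∀ j, ∫ z, f (Pi.single j (x⁻¹ • z)) ∂μ = ∫ w, f (Pi.single j (x⁻¹ • w j)) ∂Q :=
    fun j => by
      conv_lhs => rw [← (measurePreserving_eval (fun _ : J => μ) j).map_eq]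
      exact integral_map (measurable_pi_apply j).aemeasurable (hcs j).aestronglyMeasurable
  simp_rw [e2]
  rw [← integral_finsetSum _ fun j _ => i2 j, ← integral_sub i1 (integrable_finsetSum _
    fun j _ => i2 j)]
  have hi1 : ∀ j, Integrable (fun w => {w : J → F | ε * x < ‖w j‖}.indicator (fun _ => κ) w +
      {w : J → F | R * x < ‖w j‖}.indicator (fun _ => 2 * M) w) Q := fun j =>
    (ic _ _ (ms _ j)).add (ic _ _ (ms _ j))
  have hi2 : ∀ q : J × J, Integrable (fun w =>
      {w : J → F | δ * x < ‖w q.1‖ ∧ δ * x < ‖w q.2‖}.indicator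
        (fun _ => (Fintype.card J + 1) * M) w) Q := fun q =>
    ic _ _ (ms2 _ q)
  calc _ ≤ ∫ w, |f (x⁻¹ • w) - ∑ j, f (Pi.single j (x⁻¹ • w j))| ∂Q :=
        abs_integral_le_integral_abs
    _ ≤ ∫ w, (∑ j, ({w : J → F | ε * x < ‖w j‖}.indicator (fun _ => κ) w +
        {w : J → F | R * x < ‖w j‖}.indicator (fun _ => 2 * M) w) +
      ∑ q ∈ Finset.univ.offDiag, {w : J → F | δ * x < ‖w q.1‖ ∧ δ * x < ‖w q.2‖}.indicator
        (fun _ => (Fintype.card J + 1) * M) w) ∂Q := by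
        refine integral_mono (i1.sub (integrable_finsetSum _ fun j _ => i2 j)).abs
          ((integrable_finsetSum _ fun j _ => hi1 j).add
            (integrable_finsetSum _ fun q _ => hi2 q)) fun w => ?_
        have := abs_sub_sum_single_le hM hκ hε hδ hδε hεR h0 hmod (x⁻¹ • w)
        simpa only [Set.indicator, Set.mem_ofPred_eq, Pi.smul_apply, hsc] using this
    _ = ∑ j : J, (tail μ (ε * x) * κ + tail μ (R * x) * (2 * M)) +
        ∑ q ∈ (Finset.univ : Finset J).offDiag,
          tail μ (δ * x) ^ 2 * ((Fintype.card J + 1) * M) := by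
        rw [integral_add (integrable_finsetSum _ fun j _ => hi1 j)
          (integrable_finsetSum _ fun q _ => hi2 q), integral_finsetSum _ fun j _ => hi1 j,
          integral_finsetSum _ fun q _ => hi2 q]
        congr 1
        · refine Finset.sum_congr rfl fun j _ => ?_
          rw [integral_add (ic _ _ (ms _ j)) (ic _ _ (ms _ j)), vi _ _ (ms _ j),
            vi _ _ (ms _ j), measureReal_pi_coord, measureReal_pi_coord]
        · refine Finset.sum_congr rfl fun q hq => ?_
          rw [vi _ _ (ms2 _ q),
            measureReal_pi_coord_pair μ (Finset.mem_offDiag.1 hq).2.2]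
    _ ≤ _ := by
        rw [Finset.sum_const, Finset.sum_const, nsmul_eq_mul, nsmul_eq_mul, Finset.card_univ]
        have hc : (((Finset.univ : Finset J).offDiag.card : ℕ) : ℝ) ≤ (Fintype.card J : ℝ) ^ 2 := by
          rw [Finset.offDiag_card, Finset.card_univ, sq]
          exact_mod_cast Nat.sub_le _ _
        gcongr

/-- The tail measure of a vector of independent regularly varying vectors is concentrated on the
axes. -/
lemma RegVarLaw.tendsto_integral_pi (h : RegVarLaw μ S α) (hα : 0 < α)
    (hS : ∀ᵐ θ ∂S, ‖θ‖ = 1) (f : (J → F) →ᵇ ℝ) {ε : ℝ} (hε : 0 < ε)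
    (h0 : ∀ w, ‖w‖ ≤ ε → f w = 0) :
    Tendsto (fun x : ℝ => (∫ w, f (x⁻¹ • w) ∂(Measure.pi fun _ : J => μ)) / tail μ x) atTop
      (𝓝 (∑ j, ∫ z, f (Pi.single j z) ∂(limitMeasure S α))) := by
  set n : ℝ := (Fintype.card J : ℝ) with hn
  have hM : ∀ w, |f w| ≤ ‖f‖ := fun w => f.norm_coe_le_norm w
  refine tendsto_of_forall_approx fun κ hκ => ?_
  refine ⟨fun x => ∑ j, (∫ z, f (Pi.single j (x⁻¹ • z)) ∂μ) / tail μ x,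
    ∑ j, ∫ z, f (Pi.single j z) ∂(limitMeasure S α),
    tendsto_finsetSum _ fun j _ => ?_, (by simpa using hκ.le), ?_⟩
  · exact h.tendsto_integral hα hS
      (f.compContinuous ⟨fun z : F => Pi.single j z, continuous_single (A := fun _ : J => F) j⟩) hε
      fun z hz => h0 (Pi.single j z) (by rwa [Pi.norm_single])
  have hεα : 0 < ε ^ (-α) := by positivity
  have hn0 : 0 ≤ n := Nat.cast_nonneg _
  -- This tolerance keeps the limiting modulus error `n * ε ^ (-α) * κ'` below `κ / 3`; the choice
  -- of `R` bounds the far-out error by another third.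
  set κ' := κ / (3 * (n + 1) * ε ^ (-α)) with hκ'
  have hκ'0 : 0 < κ' := by positivity
  have hR : Tendsto (fun R : ℝ => n * (R ^ (-α) * (2 * ‖f‖))) atTop (𝓝 0) := by
    simpa using ((tendsto_rpow_neg_atTop hα).mul_const (2 * ‖f‖)).const_mul n
  obtain ⟨R, hR1, hR2⟩ := ((hR.eventually (gt_mem_nhds (show (0 : ℝ) < κ / 3 by positivity))).and
    (eventually_ge_atTop ε)).exists
  obtain ⟨δ₀, hδ₀, hmod⟩ := exists_modulus f.continuous R hκ'0
  set δ := min δ₀ ε with hδd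
  have hδ : 0 < δ := lt_min hδ₀ hε
  have hR0 : 0 < R := hε.trans_le hR2
  -- The pair term is a convergent tail ratio times `tail μ (δ * x)`, which tends to `0`.
  have hlim : Tendsto (fun x => n * (tail μ (ε * x) / tail μ x * κ' +
      tail μ (R * x) / tail μ x * (2 * ‖f‖)) +
        n ^ 2 * (tail μ (δ * x) / tail μ x * tail μ (δ * x) * ((n + 1) * ‖f‖))) atTop
      (𝓝 (n * (ε ^ (-α) * κ' + R ^ (-α) * (2 * ‖f‖)) +
        n ^ 2 * (δ ^ (-α) * 0 * ((n + 1) * ‖f‖)))) := by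
    have hδ0 : Tendsto (fun x => tail μ (δ * x)) atTop (𝓝 0) :=
      tendsto_tail_atTop.comp (tendsto_id.const_mul_atTop hδ)
    exact ((((h.tendsto_tail hε).mul_const _).add ((h.tendsto_tail hR0).mul_const _)).const_mul
      _).add ((((h.tendsto_tail hδ).mul hδ0).mul_const _).const_mul _)
  have hlt : n * (ε ^ (-α) * κ' + R ^ (-α) * (2 * ‖f‖)) +
        n ^ 2 * (δ ^ (-α) * 0 * ((n + 1) * ‖f‖)) < κ := by
    have e1 : n * (ε ^ (-α) * κ') ≤ κ / 3 := by
      calc n * (ε ^ (-α) * κ') ≤ (n + 1) * (ε ^ (-α) * κ') := by gcongr; linarith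
        _ = κ / 3 := by rw [hκ']; field_simp
    nlinarith
  filter_upwards [hlim.eventually (gt_mem_nhds hlt), eventually_gt_atTop 0] with x h1 hx
  have hV := h.tail_pos x
  have key := abs_integral_pi_sub_le (μ := μ) (f := f) hM hκ'0.le hε.le hδ.le (min_le_right _ _)
    hR2 h0 (fun w w' a b c => hmod w w' a b (c.trans (min_le_left _ _))) hx
  rw [← hn] at key
  rw [← Finset.sum_div, ← sub_div, abs_div, abs_of_pos hV, div_le_iff₀ hV]
  refine key.trans ((le_of_eq ?_).trans (mul_le_mul_of_nonneg_right h1.le hV.le))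
  field_simp

end BigJump

/-! ### Continuous approximation of exceedance events -/

section Ramp

variable {W V : Type*} [NormedAddCommGroup W] [NormedSpace ℝ W] [NormedAddCommGroup V]
  [NormedSpace ℝ V]

/-- A continuous minorant of `w ↦ f (w / ‖T w‖) · 1{‖T w‖ > 1}`, which is exact where
`‖T w‖ ≥ c`. -/
noncomputable def ramp (T : W →L[ℝ] V) (f : W →ᵇ ℝ) (c : ℝ) : W →ᵇ ℝ :=
  BoundedContinuousFunction.ofNormedAddCommGroup
    -- The maximum with `1` keeps the inverse continuous and changes nothing where the second factor
    -- is nonzero.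
    (fun w => f ((max 1 ‖T w‖)⁻¹ • w) * min 1 (max 0 ((‖T w‖ - 1) / (c - 1))))
    (by
      have hne : ∀ w, max 1 ‖T w‖ ≠ 0 := fun w =>
        (lt_of_lt_of_le one_pos (le_max_left _ _)).ne'
      have h1 : Continuous fun w => (max 1 ‖T w‖)⁻¹ • w :=
        ((continuous_const.max T.continuous.norm).inv₀ hne).smul continuous_id
      exact (f.continuous.comp h1).mul (by fun_prop))
    ‖f‖
    (fun w => by
      have h2 : ‖min 1 (max 0 ((‖T w‖ - 1) / (c - 1)))‖ ≤ 1 := by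
        rw [Real.norm_of_nonneg (le_min zero_le_one (le_max_left _ _))]
        exact min_le_left _ _
      rw [norm_mul]
      simpa using mul_le_mul (f.norm_coe_le_norm _) h2 (norm_nonneg _) (norm_nonneg f))

lemma ramp_apply (T : W →L[ℝ] V) (f : W →ᵇ ℝ) (c : ℝ) (w : W) :
    ramp T f c w = f ((max 1 ‖T w‖)⁻¹ • w) * min 1 (max 0 ((‖T w‖ - 1) / (c - 1))) := rfl

variable {T : W →L[ℝ] V} {f : W →ᵇ ℝ} {c : ℝ}

lemma ramp_eq_zero (hc : 1 < c) {w : W} (hw : ‖T w‖ ≤ 1) : ramp T f c w = 0 := by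
  rw [ramp_apply, max_eq_left (div_nonpos_of_nonpos_of_nonneg (by linarith) (by linarith))]
  simp

/-- Vague convergence admits only test functions that vanish near the origin; continuity of `T`
provides the radius. -/
lemma ramp_eq_zero_of_norm_le (hc : 1 < c) {w : W} (hw : ‖w‖ ≤ (‖T‖ + 1)⁻¹) :
    ramp T f c w = 0 := by
  refine ramp_eq_zero hc ((T.le_opNorm w).trans ?_)
  have := norm_nonneg T
  calc ‖T‖ * ‖w‖ ≤ (‖T‖ + 1) * (‖T‖ + 1)⁻¹ := by gcongr; linarith
    _ = 1 := mul_inv_cancel₀ (by positivity)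

lemma ramp_le (hc : 1 < c) (hf : ∀ w, 0 ≤ f w) (w : W) :
    ramp T f c w ≤ {w | 1 < ‖T w‖}.indicator (fun w => f (‖T w‖⁻¹ • w)) w := by
  by_cases hw : 1 < ‖T w‖
  · rw [Set.indicator_of_mem (s := {w | 1 < ‖T w‖}) hw, ramp_apply, max_eq_right hw.le]
    exact mul_le_of_le_one_right (hf _) (min_le_left _ _)
  · rw [Set.indicator_of_notMem (s := {w | 1 < ‖T w‖}) hw, ramp_eq_zero hc (not_lt.1 hw)]

lemma le_ramp (hc : 1 < c) (hf : ∀ w, 0 ≤ f w) (w : W) :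
    {w | c < ‖T w‖}.indicator (fun w => f (‖T w‖⁻¹ • w)) w ≤ ramp T f c w := by
  by_cases hw : c < ‖T w‖
  · rw [Set.indicator_of_mem (s := {w | c < ‖T w‖}) hw, ramp_apply,
      max_eq_right (hc.trans hw).le, min_eq_left, mul_one]
    exact le_max_of_le_right ((one_le_div (by linarith)).2 (by linarith))
  · rw [Set.indicator_of_notMem (s := {w | c < ‖T w‖}) hw, ramp_apply]
    exact mul_nonneg (hf _) (le_min zero_le_one (le_max_left _ _))

end Ramp

/-! ### Exceedances of a deterministic linear image -/

section Exceedance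

variable {J F V : Type*} [Fintype J] [DecidableEq J] [NormedAddCommGroup F] [NormedSpace ℝ F]
  [FiniteDimensional ℝ F] [MeasurableSpace F] [BorelSpace F] [NormedAddCommGroup V]
  [NormedSpace ℝ V] {μ S : Measure F} [IsProbabilityMeasure μ] [IsProbabilityMeasure S] {α : ℝ}

omit [FiniteDimensional ℝ F] in
-- The polar decomposition is stated for gauges rather than norms for this case: `T` may vanish on
-- part of an axis.
lemma isGauge_norm_single (T : (J → F) →L[ℝ] V) (j : J) :
    IsGauge (fun z : F => ‖T (Pi.single j z)‖) where
  measurable := (T.continuous.comp (continuous_single (A := fun _ : J => F) j)).norm.measurable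
  nonneg _ := norm_nonneg _
  smul r hr z := by
    rw [Pi.single_smul, map_smul, norm_smul, Real.norm_of_nonneg hr.le]
  bound := ⟨‖T‖, fun z => by simpa [Pi.norm_single] using T.le_opNorm (Pi.single j z)⟩

omit [DecidableEq J] in
lemma integral_ramp_pi_bounds (T : (J → F) →L[ℝ] V) {f : (J → F) →ᵇ ℝ} (hf : ∀ w, 0 ≤ f w)
    {c : ℝ} (hc : 1 < c) {x : ℝ} (hx : 0 < x) :
    (∫ w in {w | c * x < ‖T w‖}, f (‖T w‖⁻¹ • w) ∂(Measure.pi fun _ : J => μ)) ≤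
        ∫ w, ramp T f c (x⁻¹ • w) ∂(Measure.pi fun _ : J => μ) ∧
      ∫ w, ramp T f c (x⁻¹ • w) ∂(Measure.pi fun _ : J => μ) ≤
        ∫ w in {w | x < ‖T w‖}, f (‖T w‖⁻¹ • w) ∂(Measure.pi fun _ : J => μ) := by
  have hTm : Measurable fun w : J → F => ‖T w‖ := T.continuous.norm.measurable
  have ms : ∀ t : ℝ, MeasurableSet {w : J → F | t < ‖T w‖} := fun t =>
    measurableSet_lt measurable_const hTm
  have hfm : Measurable fun w : J → F => f (‖T w‖⁻¹ • w) :=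
    f.continuous.measurable.comp (hTm.inv.smul measurable_id)
  have i1 : Integrable (fun w => ramp T f c (x⁻¹ • w)) (Measure.pi fun _ : J => μ) :=
    Integrable.of_bound ((ramp T f c).continuous.comp (by fun_prop)).aestronglyMeasurable _
      (ae_of_all _ fun w => (ramp T f c).norm_coe_le_norm _)
  have i2 : ∀ t : ℝ, Integrable ({w | t < ‖T w‖}.indicator fun w => f (‖T w‖⁻¹ • w))
      (Measure.pi fun _ : J => μ) := fun t =>
    integrable_indicator_of_bounded (ms t) (measure_lt_top _ _) hfm
      fun w => f.norm_coe_le_norm _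
  have e1 : ∀ (t : ℝ) (w : J → F), t < ‖T (x⁻¹ • w)‖ ↔ t * x < ‖T w‖ := fun t w => by
    rw [map_smul, norm_smul, norm_inv, Real.norm_of_nonneg hx.le, inv_mul_eq_div,
      lt_div_iff₀ hx]
  have e2 : ∀ w : J → F, ‖T (x⁻¹ • w)‖⁻¹ • x⁻¹ • w = ‖T w‖⁻¹ • w := fun w => by
    rw [map_smul, norm_smul, norm_inv, Real.norm_of_nonneg hx.le, smul_smul]
    congr 1
    rw [mul_inv, inv_inv]
    field_simp
  rw [← integral_indicator (ms _), ← integral_indicator (ms _)]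
  constructor
  · refine integral_mono (i2 _) i1 fun w => ?_
    have := le_ramp (T := T) hc hf (x⁻¹ • w)
    simpa only [Set.indicator, Set.mem_ofPred_eq, e1, e2] using this
  · refine integral_mono i1 (i2 _) fun w => ?_
    have := ramp_le (T := T) hc hf (x⁻¹ • w)
    simpa only [Set.indicator, Set.mem_ofPred_eq, e1, e2, one_mul] using this

/-- The ramp lies between the exceedance functionals at levels `c` and `1`, whose integrals along
axis `j` are explicit by the polar decomposition. -/
lemma integral_ramp_limitMeasure_bounds (hα : 0 < α) (hS : ∀ᵐ θ ∂S, ‖θ‖ = 1)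
    (T : (J → F) →L[ℝ] V) {f : (J → F) →ᵇ ℝ} (hf : ∀ w, 0 ≤ f w) {c : ℝ} (hc : 1 < c) (j : J) :
    c ^ (-α) * (∫ θ, f (‖T (Pi.single j θ)‖⁻¹ • Pi.single j θ) * ‖T (Pi.single j θ)‖ ^ α ∂S) ≤
        ∫ z, ramp T f c (Pi.single j z) ∂(limitMeasure S α) ∧
      ∫ z, ramp T f c (Pi.single j z) ∂(limitMeasure S α) ≤
        ∫ θ, f (‖T (Pi.single j θ)‖⁻¹ • Pi.single j θ) * ‖T (Pi.single j θ)‖ ^ α ∂S := by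
  have hp := isGauge_norm_single T j
  have hsc : Continuous fun z : F => (Pi.single j z : J → F) :=
    continuous_single (A := fun _ : J => F) j
  set g : F → ℝ := fun z => f (Pi.single j z) with hg
  have hgm : Measurable g := (f.continuous.comp hsc).measurable
  have hgM : ∀ z, |g z| ≤ ‖f‖ := fun z => f.norm_coe_le_norm _
  have ms : ∀ t : ℝ, MeasurableSet {z : F | t < ‖T (Pi.single j z)‖} := fun t =>
    measurableSet_lt measurable_const hp.measurable
  have hpolar : ∀ t : ℝ, 0 < t → ∫ z, {z : F | t < ‖T (Pi.single j z)‖}.indicator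
      (fun z => g (‖T (Pi.single j z)‖⁻¹ • z)) z ∂(limitMeasure S α) =
      t ^ (-α) * ∫ θ, f (‖T (Pi.single j θ)‖⁻¹ • Pi.single j θ) *
        ‖T (Pi.single j θ)‖ ^ α ∂S := fun t ht => by
    rw [integral_indicator (ms t), setIntegral_limitMeasure hα hS hp hgm hgM ht]
    simp only [hg, Pi.single_smul]
  have i2 : ∀ t : ℝ, 0 < t → Integrable ({z : F | t < ‖T (Pi.single j z)‖}.indicator
      (fun z => g (‖T (Pi.single j z)‖⁻¹ • z))) (limitMeasure S α) := fun t ht =>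
    integrable_indicator_of_bounded (ms t) (limitMeasure_gauge_lt_top hα hS hp ht)
      (hgm.comp (hp.measurable.inv.smul measurable_id)) fun z => hgM _
  have i1 : Integrable (fun z => ramp T f c (Pi.single j z)) (limitMeasure S α) := by
    refine integrable_of_eq_zero_near_zero (ε := (‖T‖ + 1)⁻¹)
      (limitMeasure_gauge_lt_top hα hS isGauge_norm (by positivity))
      ((ramp T f c).continuous.comp hsc).measurable
      (fun z => (ramp T f c).norm_coe_le_norm _) fun z hz => ?_
    exact ramp_eq_zero_of_norm_le hc (by rwa [Pi.norm_single])
  constructor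
  · rw [← hpolar c (by linarith)]
    refine integral_mono (i2 c (by linarith)) i1 fun z => ?_
    have := le_ramp (T := T) hc hf (Pi.single j z)
    simpa only [Set.indicator, Set.mem_ofPred_eq, hg, Pi.single_smul] using this
  · have h1 := hpolar 1 one_pos
    rw [Real.one_rpow, one_mul] at h1
    rw [← h1]
    refine integral_mono i1 (i2 1 one_pos) fun z => ?_
    have := ramp_le (T := T) hc hf (Pi.single j z)
    simpa only [Set.indicator, Set.mem_ofPred_eq, hg, Pi.single_smul] using this

/-- The ramp bounds are squeezed as `c` decreases to `1`. The ramp at scale `x` bounds the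
exceedance integral from below, and the ramp at scale `c⁻¹ * x` bounds it from above. Nonnegativity
of `f` makes the ramps monotone bounds. -/
lemma RegVarLaw.tendsto_setIntegral_pi_of_nonneg (h : RegVarLaw μ S α) (hα : 0 < α)
    (hS : ∀ᵐ θ ∂S, ‖θ‖ = 1) (T : (J → F) →L[ℝ] V) {f : (J → F) →ᵇ ℝ} (hf : ∀ w, 0 ≤ f w) :
    Tendsto (fun x : ℝ => (∫ w in {w | x < ‖T w‖}, f (‖T w‖⁻¹ • w)
        ∂(Measure.pi fun _ : J => μ)) / tail μ x) atTop
      (𝓝 (∑ j, ∫ θ, f (‖T (Pi.single j θ)‖⁻¹ • Pi.single j θ) *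
        ‖T (Pi.single j θ)‖ ^ α ∂S)) := by
  set L := ∑ j, ∫ θ, f (‖T (Pi.single j θ)‖⁻¹ • Pi.single j θ) *
        ‖T (Pi.single j θ)‖ ^ α ∂S with hL
  have hramp : ∀ c : ℝ, 1 < c → ∃ A, c ^ (-α) * L ≤ A ∧ A ≤ L ∧
      Tendsto (fun x : ℝ => (∫ w, ramp T f c (x⁻¹ • w) ∂(Measure.pi fun _ : J => μ)) / tail μ x)
        atTop (𝓝 A) := fun c hc => by
    refine ⟨_, ?_, ?_, h.tendsto_integral_pi hα hS (ramp T f c)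
      (show (0 : ℝ) < (‖T‖ + 1)⁻¹ by positivity) fun w hw => ramp_eq_zero_of_norm_le hc hw⟩
    · rw [hL, Finset.mul_sum]
      exact Finset.sum_le_sum fun j _ => (integral_ramp_limitMeasure_bounds hα hS T hf hc j).1
    · exact Finset.sum_le_sum fun j _ => (integral_ramp_limitMeasure_bounds hα hS T hf hc j).2
  have hcont : ∀ a : ℝ, Tendsto (fun c : ℝ => c ^ a * L) (𝓝[>] 1) (𝓝 L) := fun a => by
    have h1 : ContinuousAt (fun c : ℝ => c ^ a * L) 1 :=
      (Real.continuousAt_rpow_const 1 a (Or.inl one_ne_zero)).mul continuousAt_const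
    simpa using h1.tendsto.mono_left nhdsWithin_le_nhds
  refine tendsto_order.2 ⟨fun a ha => ?_, fun a ha => ?_⟩
  · obtain ⟨c, hc1, hc⟩ := (((hcont (-α)).eventually (lt_mem_nhds ha)).and
      self_mem_nhdsWithin).exists
    obtain ⟨A, hA1, -, hA⟩ := hramp c hc
    filter_upwards [hA.eventually (lt_mem_nhds (hc1.trans_le hA1)), eventually_gt_atTop 0]
      with x h1 hx
    exact h1.trans_le (div_le_div_of_nonneg_right (integral_ramp_pi_bounds T hf hc hx).2
      (tail_nonneg x))
  · obtain ⟨c, hc1, hc⟩ := (((hcont α).eventually (gt_mem_nhds ha)).and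
      self_mem_nhdsWithin).exists
    have hc0 : (0 : ℝ) < c := one_pos.trans hc
    obtain ⟨A, -, hA2, hA⟩ := hramp c hc
    -- The change of scale costs the factor `tail μ (c⁻¹ * x) / tail μ x`, with limit `c ^ α`.
    have h2 := (hA.comp (tendsto_id.const_mul_atTop (inv_pos.2 hc0))).mul
      (h.tendsto_tail (inv_pos.2 hc0))
    have hlt : A * c⁻¹ ^ (-α) < a := by
      rw [Real.inv_rpow hc0.le, Real.rpow_neg hc0.le, inv_inv, mul_comm]
      refine lt_of_le_of_lt ?_ hc1
      gcongr
    filter_upwards [h2.eventually (gt_mem_nhds hlt), eventually_gt_atTop 0] with x h1 hx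
    refine lt_of_le_of_lt ?_ h1
    have hx' : 0 < c⁻¹ * x := by positivity
    have key := (integral_ramp_pi_bounds (μ := μ) T hf hc hx').1
    rw [mul_inv_cancel_left₀ hc0.ne'] at key
    simp only [Function.comp, id]
    rw [div_mul_div_cancel₀ (h.tail_pos _).ne']
    exact div_le_div_of_nonneg_right key (tail_nonneg x)

/-- Asymptotics of a test function of the direction of a vector of independent regularly varying
vectors, on the exceedances of the norm of a linear image. -/
lemma RegVarLaw.tendsto_setIntegral_pi (h : RegVarLaw μ S α) (hα : 0 < α)
    (hS : ∀ᵐ θ ∂S, ‖θ‖ = 1) (T : (J → F) →L[ℝ] V) (f : (J → F) →ᵇ ℝ) :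
    Tendsto (fun x : ℝ => (∫ w in {w | x < ‖T w‖}, f (‖T w‖⁻¹ • w)
        ∂(Measure.pi fun _ : J => μ)) / tail μ x) atTop
      (𝓝 (∑ j, ∫ θ, f (‖T (Pi.single j θ)‖⁻¹ • Pi.single j θ) *
        ‖T (Pi.single j θ)‖ ^ α ∂S)) := by
  -- Adding the constant `‖f‖` makes the test function nonnegative; its own contribution is
  -- subtracted afterwards.
  set b : (J → F) →ᵇ ℝ := BoundedContinuousFunction.const _ ‖f‖ with hb
  have h1 := h.tendsto_setIntegral_pi_of_nonneg hα hS T (f := f + b) fun w => by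
    have := (abs_le.1 (f.norm_coe_le_norm w)).1
    simp only [hb, BoundedContinuousFunction.add_apply, BoundedContinuousFunction.const_apply]
    linarith
  have h2 := h.tendsto_setIntegral_pi_of_nonneg hα hS T (f := b) fun w => norm_nonneg f
  have hTm : Measurable fun w : J → F => ‖T w‖ := T.continuous.norm.measurable
  have ig : ∀ (g : (J → F) →ᵇ ℝ) (x : ℝ), IntegrableOn (fun w => g (‖T w‖⁻¹ • w))
      {w | x < ‖T w‖} (Measure.pi fun _ : J => μ) := fun g x =>
    Integrable.of_bound (g.continuous.measurable.comp
      (hTm.inv.smul measurable_id)).aestronglyMeasurable ‖g‖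
      (ae_of_all _ fun w => g.norm_coe_le_norm _)
  have is : ∀ (g : (J → F) →ᵇ ℝ) (j : J), Integrable (fun θ =>
      g (‖T (Pi.single j θ)‖⁻¹ • Pi.single j θ) * ‖T (Pi.single j θ)‖ ^ α) S := fun g j => by
    have hm := (isGauge_norm_single T j).measurable
    have hsc : Measurable fun z : F => (Pi.single j z : J → F) :=
      (continuous_single (A := fun _ : J => F) j).measurable
    refine Integrable.of_bound ((g.continuous.measurable.comp (hm.inv.smul hsc)).mul
      (hm.pow_const α)).aestronglyMeasurable (‖g‖ * ‖T‖ ^ α) ?_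
    filter_upwards [hS] with θ hθ
    have : ‖T (Pi.single j θ)‖ ≤ ‖T‖ := by
      simpa [Pi.norm_single, hθ] using T.le_opNorm (Pi.single j θ)
    rw [norm_mul, Real.norm_of_nonneg (show 0 ≤ ‖T (Pi.single j θ)‖ ^ α by positivity)]
    exact mul_le_mul (g.norm_coe_le_norm _) (Real.rpow_le_rpow (norm_nonneg _) this hα.le)
      (by positivity) (norm_nonneg _)
  have h3 := h1.sub h2
  rw [← Finset.sum_sub_distrib] at h3
  simp_rw [← integral_sub (is _ _) (is _ _), ← sub_mul, ← sub_div,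
    ← integral_sub (ig _ _) (ig _ _)] at h3
  simpa only [BoundedContinuousFunction.add_apply, hb, BoundedContinuousFunction.const_apply,
    add_sub_cancel_right] using h3

end Exceedance

/-! ### Random coefficients: Potter bound and dominated convergence -/

section RandomCoefficients

variable {Ω J F U V : Type*} [MeasurableSpace Ω] {P : Measure Ω} [IsProbabilityMeasure P]
  [Fintype J] [NormedAddCommGroup F] [NormedSpace ℝ F]
  [FiniteDimensional ℝ F] [MeasurableSpace F] [BorelSpace F]
  [NormedAddCommGroup U] [NormedSpace ℝ U] [FiniteDimensional ℝ U] [MeasurableSpace U]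
  [BorelSpace U]
  [NormedAddCommGroup V] [NormedSpace ℝ V] [FiniteDimensional ℝ V] [MeasurableSpace V]
  [BorelSpace V]
  {μ S : Measure F} [IsProbabilityMeasure μ] [IsProbabilityMeasure S] {α β : ℝ}

/-- The linear map `w ↦ ∑ j, B j (w j)`. -/
noncomputable def sumMap (B : J → F →L[ℝ] V) : (J → F) →L[ℝ] V :=
  ∑ j, (B j).comp (ContinuousLinearMap.proj j)

omit [FiniteDimensional ℝ F] [MeasurableSpace F] [BorelSpace F] [FiniteDimensional ℝ V]
  [MeasurableSpace V] [BorelSpace V] in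
lemma sumMap_apply (B : J → F →L[ℝ] V) (w : J → F) : sumMap B w = ∑ j, B j (w j) := by
  simp [sumMap]

omit [FiniteDimensional ℝ F] [MeasurableSpace F] [BorelSpace F] [FiniteDimensional ℝ V]
  [MeasurableSpace V] [BorelSpace V] in
lemma sumMap_single [DecidableEq J] (B : J → F →L[ℝ] V) (j : J) (z : F) :
    sumMap B (Pi.single j z) = B j z := by
  rw [sumMap_apply, Finset.sum_eq_single j]
  · simp
  · intro i _ hi
    simp [Pi.single_eq_of_ne hi]
  · simp

omit [FiniteDimensional ℝ F] [FiniteDimensional ℝ V] [MeasurableSpace V] [BorelSpace V] in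
-- If every `‖w j‖` is at most its threshold, each of the `card J` summands is at most `x / card J`.
-- The `+ 1` keeps the divisor positive when `b j = 0`, as the Potter bound requires.
lemma measureReal_sumMap_le (B : J → F →L[ℝ] V) {b : J → ℝ} (hb : ∀ j, ‖B j‖ ≤ b j) {x : ℝ}
    (hx : 0 ≤ x) :
    (Measure.pi fun _ : J => μ).real {w | x < ‖sumMap B w‖} ≤
      ∑ j, tail μ (x / (Fintype.card J * b j + 1)) := by
  have hb0 : ∀ j, 0 ≤ b j := fun j => (norm_nonneg _).trans (hb j)
  have hsub : {w : J → F | x < ‖sumMap B w‖} ⊆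
      ⋃ j, {w : J → F | x / (Fintype.card J * b j + 1) < ‖w j‖} := by
    intro w hw
    by_contra hcon
    simp only [Set.mem_iUnion, Set.mem_ofPred_eq, not_exists, not_lt] at hcon
    refine not_le.2 (show x < ‖sumMap B w‖ from hw) ?_
    have hterm : ∀ j, ‖B j (w j)‖ ≤ x / Fintype.card J := fun j => by
      have hn : (0 : ℝ) < Fintype.card J := by
        have : Nonempty J := ⟨j⟩
        exact_mod_cast Fintype.card_pos
      have hd : 0 < Fintype.card J * b j + 1 := by have := hb0 j; positivity
      calc ‖B j (w j)‖ ≤ ‖B j‖ * ‖w j‖ := (B j).le_opNorm _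
        _ ≤ b j * (x / (Fintype.card J * b j + 1)) :=
          mul_le_mul (hb j) (hcon j) (norm_nonneg _) (hb0 j)
        _ ≤ x / Fintype.card J := by
          rw [← mul_div_assoc, div_le_div_iff₀ hd hn]
          nlinarith
    calc ‖sumMap B w‖ ≤ ∑ j, ‖B j (w j)‖ := by rw [sumMap_apply]; exact norm_sum_le _ _
      _ ≤ ∑ _j : J, x / Fintype.card J := Finset.sum_le_sum fun j _ => hterm j
      _ ≤ x := by
        rw [Finset.sum_const, nsmul_eq_mul, Finset.card_univ]
        rcases eq_or_ne (Fintype.card J : ℝ) 0 with hJ | hJ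
        · simp [hJ, hx]
        · exact (mul_div_cancel₀ x hJ).le
  refine (measureReal_mono hsub).trans ((measureReal_iUnion_fintype_le _).trans ?_)
  exact Finset.sum_le_sum fun j _ => (measureReal_pi_coord μ j _).le

omit [FiniteDimensional ℝ V] [FiniteDimensional ℝ F] [BorelSpace F] in
-- On the unit sphere `‖B ω θ‖ ≤ b ω`, and on a probability space a moment of order `β` controls the
-- one of order `α`.
lemma integrable_mul_norm_rpow (hα : 0 < α) (hβ : α ≤ β) (hS : ∀ᵐ θ ∂S, ‖θ‖ = 1)
    {B : Ω → F →L[ℝ] V} (hB : Measurable fun z : Ω × F => B z.1 z.2) {b : Ω → ℝ}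
    (hb : ∀ ω, ‖B ω‖ ≤ b ω) (hbL : MemLp b (ENNReal.ofReal β) P) {g : Ω × F → ℝ}
    (hg : Measurable g) {M : ℝ} (hM : ∀ z, |g z| ≤ M) :
    Integrable (fun z : Ω × F => g z * ‖B z.1 z.2‖ ^ α) (P.prod S) := by
  have hb0 : ∀ ω, 0 ≤ b ω := fun ω => (norm_nonneg _).trans (hb ω)
  have h1 : Integrable (fun ω => b ω ^ α) P := by
    have h2 := (hbL.mono_exponent (ENNReal.ofReal_le_ofReal hβ)).integrable_norm_rpow
      (by simpa using hα) ENNReal.ofReal_ne_top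
    simpa [ENNReal.toReal_ofReal hα.le, abs_of_nonneg (hb0 _)] using h2
  have h3 : Integrable (fun z : Ω × F => M * b z.1 ^ α) (P.prod S) :=
    (h1.comp_fst S).const_mul M
  refine h3.mono' (hg.mul (hB.norm.pow_const α)).aestronglyMeasurable ?_
  have h4 : ∀ᵐ z ∂(P.prod S), ‖z.2‖ = 1 := Measure.quasiMeasurePreserving_snd.ae hS
  filter_upwards [h4] with z hz
  have h5 : ‖B z.1 z.2‖ ≤ b z.1 := by
    simpa [hz] using ((B z.1).le_opNorm z.2).trans
      (mul_le_mul_of_nonneg_right (hb z.1) (norm_nonneg _))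
  rw [norm_mul, Real.norm_of_nonneg (show 0 ≤ ‖B z.1 z.2‖ ^ α by positivity)]
  exact mul_le_mul (hM z) (Real.rpow_le_rpow (norm_nonneg _) h5 hα.le) (by positivity)
    ((abs_nonneg _).trans (hM z))

omit [FiniteDimensional ℝ F] [BorelSpace F] in
lemma measurable_sumMap {B : J → Ω → F →L[ℝ] V}
    (hB : ∀ j, Measurable fun z : Ω × F => B j z.1 z.2) :
    Measurable fun z : Ω × (J → F) => sumMap (fun j => B j z.1) z.2 := by
  simp_rw [sumMap_apply]
  exact Finset.measurable_sum _ fun j _ =>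
    (hB j).comp (measurable_fst.prodMk ((measurable_pi_apply j).comp measurable_snd))

/-- The test functional of `w` and of the random coefficients. -/
noncomputable def exceed (A : J → F →L[ℝ] U) (B : J → F →L[ℝ] V) (f : U →ᵇ ℝ) (x : ℝ)
    (w : J → F) : ℝ :=
  {w : J → F | x < ‖sumMap B w‖}.indicator (fun w => f (‖sumMap B w‖⁻¹ • sumMap A w)) w

omit [FiniteDimensional ℝ F] [MeasurableSpace F] [BorelSpace F] [FiniteDimensional ℝ U]
  [MeasurableSpace U] [BorelSpace U] [FiniteDimensional ℝ V]
  [MeasurableSpace V] [BorelSpace V] in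
lemma abs_exceed_le (A : J → F →L[ℝ] U) (B : J → F →L[ℝ] V) (f : U →ᵇ ℝ) (x : ℝ) (w : J → F) :
    |exceed A B f x w| ≤ {w : J → F | x < ‖sumMap B w‖}.indicator (fun _ => ‖f‖) w := by
  unfold exceed
  by_cases hw : x < ‖sumMap B w‖
  · simpa [Set.indicator, hw] using f.norm_coe_le_norm _
  · simp [Set.indicator, hw]

omit [FiniteDimensional ℝ F] [BorelSpace F] in
lemma measurable_exceed {A : J → Ω → F →L[ℝ] U} {B : J → Ω → F →L[ℝ] V}
    (hA : ∀ j, Measurable fun z : Ω × F => A j z.1 z.2)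
    (hB : ∀ j, Measurable fun z : Ω × F => B j z.1 z.2) (f : U →ᵇ ℝ) (x : ℝ) :
    Measurable fun z : Ω × (J → F) =>
      exceed (fun j => A j z.1) (fun j => B j z.1) f x z.2 := by
  have h1 := measurable_sumMap hA
  have h2 := (measurable_sumMap hB).norm
  have h3 : Measurable fun z : Ω × (J → F) =>
      f (‖sumMap (fun j => B j z.1) z.2‖⁻¹ • sumMap (fun j => A j z.1) z.2) :=
    f.continuous.measurable.comp (h2.inv.smul h1)
  exact h3.indicator (measurableSet_lt measurable_const h2)

/-- For fixed `ω` this is the result for deterministic maps. The union bound followed by the Potter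
bound dominates the ratio by a multiple of `∑ j, (1 + (n * b j ω + 1) ^ β)`, which is integrable and
free of `x`. -/
lemma RegVarLaw.tendsto_integral_exceed (h : RegVarLaw μ S α) (hα : 0 < α) (hβ : α < β)
    (hS : ∀ᵐ θ ∂S, ‖θ‖ = 1) {A : J → Ω → F →L[ℝ] U} {B : J → Ω → F →L[ℝ] V}
    (hA : ∀ j, Measurable fun z : Ω × F => A j z.1 z.2)
    (hB : ∀ j, Measurable fun z : Ω × F => B j z.1 z.2) {b : J → Ω → ℝ}
    (hb : ∀ j ω, ‖B j ω‖ ≤ b j ω) (hbL : ∀ j, MemLp (b j) (ENNReal.ofReal β) P) (f : U →ᵇ ℝ) :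
    Tendsto (fun x : ℝ => (∫ ω, ∫ w, exceed (fun j => A j ω) (fun j => B j ω) f x w
        ∂(Measure.pi fun _ : J => μ) ∂P) / tail μ x) atTop
      (𝓝 (∑ j, ∫ z : Ω × F, f (‖B j z.1 z.2‖⁻¹ • A j z.1 z.2) * ‖B j z.1 z.2‖ ^ α
        ∂(P.prod S))) := by
  classical
  have hβ0 : 0 < β := hα.trans hβ
  have hb0 : ∀ j ω, 0 ≤ b j ω := fun j ω => (norm_nonneg _).trans (hb j ω)
  obtain ⟨K, x₀, hK, hx₀, hpot⟩ := h.exists_tail_div_le hβ hβ0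
  set n : ℝ := (Fintype.card J : ℝ) with hn
  have hint : ∀ j, Integrable (fun z : Ω × F => f (‖B j z.1 z.2‖⁻¹ • A j z.1 z.2) *
      ‖B j z.1 z.2‖ ^ α) (P.prod S) := fun j =>
    integrable_mul_norm_rpow hα hβ.le hS (hB j) (hb j) (hbL j)
      (f.continuous.measurable.comp ((hB j).norm.inv.smul (hA j)))
      fun z => f.norm_coe_le_norm _
  have hbI : ∀ j, Integrable (fun ω => (n * b j ω + 1) ^ β) P := fun j => by
    have h1 : MemLp (fun ω => n * b j ω + 1) (ENNReal.ofReal β) P :=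
      ((hbL j).const_mul n).add (memLp_const 1)
    have h2 := h1.integrable_norm_rpow (by simpa using hβ0) ENNReal.ofReal_ne_top
    refine h2.congr (ae_of_all _ fun ω => ?_)
    have := hb0 j ω
    simp only [ENNReal.toReal_ofReal hβ0.le]
    rw [Real.norm_of_nonneg (by positivity)]
  have e1 : ∑ j, ∫ z : Ω × F, f (‖B j z.1 z.2‖⁻¹ • A j z.1 z.2) * ‖B j z.1 z.2‖ ^ α
      ∂(P.prod S) = ∫ ω, ∑ j, ∫ θ, f (‖B j ω θ‖⁻¹ • A j ω θ) * ‖B j ω θ‖ ^ α ∂S ∂P := by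
    rw [integral_finsetSum _ fun j _ => (hint j).integral_prod_left]
    exact Finset.sum_congr rfl fun j _ => integral_prod _ (hint j)
  rw [e1]
  simp_rw [← integral_div]
  refine tendsto_integral_filter_of_dominated_convergence
    (fun ω => ‖f‖ * ∑ j, K * (1 + (n * b j ω + 1) ^ β)) ?_ ?_ ?_ ?_
  · refine Eventually.of_forall fun x => StronglyMeasurable.aestronglyMeasurable ?_
    refine StronglyMeasurable.integral_prod_right'
      (f := fun z : Ω × (J → F) => exceed (fun j => A j z.1) (fun j => B j z.1) f x z.2 /
        tail μ x) ?_
    exact ((measurable_exceed hA hB f x).div_const _).stronglyMeasurable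
  · filter_upwards [eventually_ge_atTop x₀] with x hx
    refine ae_of_all _ fun ω => ?_
    have hV := h.tail_pos x
    have ms : MeasurableSet {w : J → F | x < ‖sumMap (fun j => B j ω) w‖} :=
      measurableSet_lt measurable_const (sumMap fun j => B j ω).continuous.norm.measurable
    rw [integral_div, norm_div, Real.norm_of_nonneg hV.le, div_le_iff₀ hV]
    calc ‖∫ w, exceed (fun j => A j ω) (fun j => B j ω) f x w ∂(Measure.pi fun _ : J => μ)‖
        ≤ ∫ w, {w : J → F | x < ‖sumMap (fun j => B j ω) w‖}.indicator (fun _ => ‖f‖) w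
          ∂(Measure.pi fun _ : J => μ) :=
          norm_integral_le_of_norm_le (integrable_indicator_of_bounded ms (measure_lt_top _ _)
            measurable_const fun _ => le_rfl) (ae_of_all _ fun w => abs_exceed_le _ _ f x w)
      _ = (Measure.pi fun _ : J => μ).real {w | x < ‖sumMap (fun j => B j ω) w‖} * ‖f‖ := by
          rw [integral_indicator ms, setIntegral_const, smul_eq_mul]
      _ ≤ (∑ j, K * (1 + (n * b j ω + 1) ^ β) * tail μ x) * ‖f‖ := by
          gcongr
          refine (measureReal_sumMap_le (fun j => B j ω) (fun j => hb j ω)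
            (hx₀.le.trans hx)).trans (Finset.sum_le_sum fun j _ => ?_)
          refine hpot x hx _ ?_
          have := hb0 j ω
          positivity
      _ = _ := by rw [← Finset.sum_mul]; ring
  · exact (integrable_finsetSum _ fun j _ =>
      ((integrable_const 1).add (hbI j)).const_mul K).const_mul ‖f‖
  · refine ae_of_all _ fun ω => ?_
    -- Observing another linear image only composes the test function with `sumMap A`, which
    -- commutes with the scaling.
    have key := h.tendsto_setIntegral_pi hα hS (sumMap fun j => B j ω)
      (f.compContinuous ⟨sumMap fun j => A j ω, (sumMap fun j => A j ω).continuous⟩)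
    simp only [BoundedContinuousFunction.compContinuous_apply, ContinuousMap.coe_mk, map_smul,
      sumMap_single] at key
    refine key.congr fun x => ?_
    have ms : MeasurableSet {w : J → F | x < ‖sumMap (fun j => B j ω) w‖} :=
      measurableSet_lt measurable_const (sumMap fun j => B j ω).continuous.norm.measurable
    rw [integral_div, ← integral_indicator ms]
    rfl

lemma integral_comp_of_indepFun {𝒞 W : Type*} [MeasurableSpace 𝒞] [MeasurableSpace W]
    {C : Ω → 𝒞} {X : Ω → W} (hC : Measurable C) (hX : Measurable X) (hCX : IndepFun C X P)
    {G : 𝒞 × W → ℝ} (hG : Measurable G) {M : ℝ} (hM : ∀ q, |G q| ≤ M) :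
    ∫ ω, G (C ω, X ω) ∂P = ∫ ω, ∫ w, G (C ω, w) ∂(P.map X) ∂P := by
  have hm := (indepFun_iff_map_prod_eq_prod_map_map hC.aemeasurable hX.aemeasurable).1 hCX
  have : IsProbabilityMeasure (P.map X) := Measure.isProbabilityMeasure_map hX.aemeasurable
  have : IsProbabilityMeasure (P.map C) := Measure.isProbabilityMeasure_map hC.aemeasurable
  have hi : Integrable G ((P.map C).prod (P.map X)) :=
    Integrable.of_bound hG.aestronglyMeasurable M (ae_of_all _ hM)
  rw [← integral_map (hC.prodMk hX).aemeasurable hG.aestronglyMeasurable, hm, integral_prod _ hi,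
    integral_map hC.aemeasurable hi.integral_prod_left.aestronglyMeasurable]

/-- Asymptotics of a random linear transformation of independent regularly varying vectors, on the
exceedances of another random linear transformation. -/
lemma RegVarLaw.tendsto_setIntegral_random {𝒞 : Type*} [MeasurableSpace 𝒞]
    (h : RegVarLaw μ S α) (hα : 0 < α) (hβ : α < β) (hS : ∀ᵐ θ ∂S, ‖θ‖ = 1)
    {C : Ω → 𝒞} {X : Ω → J → F} (hC : Measurable C) (hX : Measurable X) (hCX : IndepFun C X P)
    (hlaw : P.map X = Measure.pi fun _ : J => μ)
    {A : J → 𝒞 → F →L[ℝ] U} {B : J → 𝒞 → F →L[ℝ] V}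
    (hA : ∀ j, Measurable fun z : 𝒞 × F => A j z.1 z.2)
    (hB : ∀ j, Measurable fun z : 𝒞 × F => B j z.1 z.2) {b : J → Ω → ℝ}
    (hb : ∀ j ω, ‖B j (C ω)‖ ≤ b j ω) (hbL : ∀ j, MemLp (b j) (ENNReal.ofReal β) P)
    (f : U →ᵇ ℝ) :
    Tendsto (fun x : ℝ => (∫ ω in {ω | x < ‖∑ j, B j (C ω) (X ω j)‖},
        f (‖∑ j, B j (C ω) (X ω j)‖⁻¹ • ∑ j, A j (C ω) (X ω j)) ∂P) / tail μ x) atTop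
      (𝓝 (∑ j, ∫ z : Ω × F, f (‖B j (C z.1) z.2‖⁻¹ • A j (C z.1) z.2) * ‖B j (C z.1) z.2‖ ^ α
        ∂(P.prod S))) := by
  have hpair : Measurable fun z : Ω × F => (C z.1, z.2) :=
    (hC.comp measurable_fst).prodMk measurable_snd
  refine (h.tendsto_integral_exceed hα hβ hS (P := P) (A := fun j ω => A j (C ω))
    (B := fun j ω => B j (C ω)) (fun j => (hA j).comp hpair) (fun j => (hB j).comp hpair)
    hb hbL f).congr fun x => ?_
  have hG := measurable_exceed hA hB f x
  have key := integral_comp_of_indepFun hC hX hCX hG (M := ‖f‖) fun q =>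
    (abs_exceed_le _ _ f x q.2).trans (Set.indicator_le_self' (fun _ _ => norm_nonneg f) _)
  simp only at key
  rw [hlaw] at key
  rw [← key, ← integral_indicator]
  · simp only [exceed, Set.indicator, Set.mem_ofPred_eq, sumMap_apply]
  · have := (measurable_sumMap hB).norm.comp (hC.prodMk hX)
    simp only [Function.comp_def, sumMap_apply] at this
    exact measurableSet_lt measurable_const this

end RandomCoefficients

/-! ### Weak convergence of angular measures and construction of spectral laws -/

section Angular

variable {Ω V : Type*} [MeasurableSpace Ω] [NormedAddCommGroup V] [NormedSpace ℝ V]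
  [FiniteDimensional ℝ V] [MeasurableSpace V] [BorelSpace V]
  {P : Measure Ω} [IsProbabilityMeasure P]

lemma integral_angularMeasure {X : Ω → V} (hX : Measurable X) (u x : ℝ) (g : V →ᵇ ℝ) :
    ∫ v, g v ∂(angularMeasure P (normSeminorm ℝ V) X u x : Measure V) =
      (∫ ω in {ω | u * x < ‖X ω‖}, g (‖X ω‖⁻¹ • X ω) ∂P) / P.real {ω | x < ‖X ω‖} := by
  have hm : Measurable fun ω => ‖X ω‖⁻¹ • X ω := hX.norm.inv.smul hX
  have e : (angularMeasure P (normSeminorm ℝ V) X u x : Measure V) =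
      (P {ω | x < ‖X ω‖}).toNNReal⁻¹ •
        (P.restrict {ω | u * x < ‖X ω‖}).map fun ω => ‖X ω‖⁻¹ • X ω := rfl
  rw [e, integral_smul_nnreal_measure,
    integral_map hm.aemeasurable g.continuous.aestronglyMeasurable, NNReal.smul_def,
    NNReal.coe_inv, smul_eq_mul, inv_mul_eq_div]
  rfl

lemma tendsto_angularMeasure_iff {X : Ω → V} (hX : Measurable X) {α : ℝ} (u : ℝ≥0)
    (S : ProbabilityMeasure V) :
    Tendsto (fun x : ℝ => angularMeasure P (normSeminorm ℝ V) X u x) atTop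
        (𝓝 (u ^ (-α) • S.toFiniteMeasure)) ↔
      ∀ g : V →ᵇ ℝ, Tendsto (fun x : ℝ =>
        (∫ ω in {ω | u * x < ‖X ω‖}, g (‖X ω‖⁻¹ • X ω) ∂P) / P.real {ω | x < ‖X ω‖}) atTop
          (𝓝 ((u : ℝ) ^ (-α) * ∫ v, g v ∂(S : Measure V))) := by
  rw [FiniteMeasure.tendsto_iff_forall_integral_tendsto]
  refine forall_congr' fun g => ?_
  have e : ∫ v, g v ∂((u ^ (-α) • S.toFiniteMeasure : FiniteMeasure V) : Measure V) =
      (u : ℝ) ^ (-α) * ∫ v, g v ∂(S : Measure V) := by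
    have e2 : ((u ^ (-α) • S.toFiniteMeasure : FiniteMeasure V) : Measure V) =
        (u ^ (-α) : ℝ≥0) • (S : Measure V) := rfl
    rw [e2, integral_smul_nnreal_measure, NNReal.smul_def, NNReal.coe_rpow, smul_eq_mul]
  simp_rw [integral_angularMeasure hX, e]

omit [NormedSpace ℝ V] [FiniteDimensional ℝ V] [IsProbabilityMeasure P] in
lemma tail_map {X : Ω → V} (hX : Measurable X) (x : ℝ) :
    tail (P.map X) x = P.real {ω | x < ‖X ω‖} := by
  rw [tail, map_measureReal_apply hX (measurableSet_lt_norm x)]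
  rfl

lemma IsRegularlyVaryingWith.regVarLaw {α : ℝ} {X : Ω → V} (hX : Measurable X)
    {S : ProbabilityMeasure V} (h : IsRegularlyVaryingWith P (normSeminorm ℝ V) α X S) :
    RegVarLaw (P.map X) (S : Measure V) α := by
  intro u hu g
  have key := (tendsto_angularMeasure_iff hX ⟨u, hu.le⟩ S).1 (h.tendsto ⟨u, hu.le⟩ hu) g
  refine key.congr fun x => ?_
  have hg : Measurable fun z : V => g (‖z‖⁻¹ • z) :=
    g.continuous.measurable.comp (measurable_norm.inv.smul measurable_id)
  rw [tail_map hX, setIntegral_map (measurableSet_lt_norm _) hg.aestronglyMeasurable hX.aemeasurable]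
  rfl

/-- The angular law of a finite family of random vectors, weighted by the `α`-th powers of their
norms. -/
lemma exists_angular_law {Z J : Type*} [MeasurableSpace Z] [Fintype J] {Q : Measure Z}
    [IsProbabilityMeasure Q] {Y : J → Z → V} (hY : ∀ j, Measurable (Y j)) {α : ℝ} (hα : 0 < α)
    (hint : ∀ j, Integrable (fun z => ‖Y j z‖ ^ α) Q) {c : ℝ} (hc : 0 < c)
    (hcY : c = ∑ j, ∫ z, ‖Y j z‖ ^ α ∂Q) :
    ∃ S : ProbabilityMeasure V, (∀ᵐ θ ∂(S : Measure V), ‖θ‖ = 1) ∧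
      ∀ g : V →ᵇ ℝ, ∫ v, g v ∂(S : Measure V) =
        c⁻¹ * ∑ j, ∫ z, g (‖Y j z‖⁻¹ • Y j z) * ‖Y j z‖ ^ α ∂Q := by
  have hnn : ∀ j z, 0 ≤ ‖Y j z‖ ^ α := fun j z => by positivity
  have hdm : ∀ j, Measurable fun z => ENNReal.ofReal (‖Y j z‖ ^ α) := fun j =>
    ((hY j).norm.pow_const α).ennreal_ofReal
  have hnm : ∀ j, Measurable fun z => ‖Y j z‖⁻¹ • Y j z := fun j => (hY j).norm.inv.smul (hY j)
  -- Each `Q` is tilted by the weight `‖Y j‖ ^ α`; the total mass of the tilts is `c`, so `c⁻¹`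
  -- normalises the sum of their angular images.
  set D : J → Measure Z := fun j => Q.withDensity fun z => ENNReal.ofReal (‖Y j z‖ ^ α) with hD
  have hDuniv : ∀ j, D j Set.univ = ENNReal.ofReal (∫ z, ‖Y j z‖ ^ α ∂Q) := fun j => by
    rw [hD, withDensity_apply _ MeasurableSet.univ, Measure.restrict_univ,
      ofReal_integral_eq_lintegral_ofReal (hint j) (ae_of_all _ (hnn j))]
  have hDfin : ∀ j, IsFiniteMeasure (D j) := fun j =>
    ⟨by rw [hDuniv]; exact ENNReal.ofReal_lt_top⟩
  set T : Measure V := ENNReal.ofReal c⁻¹ • ∑ j, (D j).map fun z => ‖Y j z‖⁻¹ • Y j z with hT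
  have hTp : IsProbabilityMeasure T := by
    constructor
    have e : ∀ j, ((D j).map fun z => ‖Y j z‖⁻¹ • Y j z) Set.univ =
        ENNReal.ofReal (∫ z, ‖Y j z‖ ^ α ∂Q) := fun j => by
      rw [Measure.map_apply (hnm j) MeasurableSet.univ, Set.preimage_univ, hDuniv]
    rw [hT, Measure.smul_apply, Measure.finsetSum_apply, Finset.sum_congr rfl fun j _ => e j,
      ← ENNReal.ofReal_sum_of_nonneg fun j _ => integral_nonneg (hnn j), ← hcY, smul_eq_mul,
      ← ENNReal.ofReal_mul (by positivity), inv_mul_cancel₀ hc.ne', ENNReal.ofReal_one]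
  refine ⟨⟨T, hTp⟩, ?_, fun g => ?_⟩
  · change ∀ᵐ θ ∂T, ‖θ‖ = 1
    rw [hT]
    refine Measure.ae_smul_measure ?_ _
    rw [ae_finsetSum_measure_iff]
    intro j _
    rw [ae_map_iff (hnm j).aemeasurable (measurableSet_eq_fun measurable_norm measurable_const),
      hD, ae_withDensity_iff (hdm j)]
    refine ae_of_all _ fun z hz => ?_
    -- The tilt ignores the zeros of `Y j`, where the normalised vector would be `0` and off the
    -- sphere.
    have hz0 : ‖Y j z‖ ≠ 0 := fun h0 => hz (by rw [h0, Real.zero_rpow hα.ne', ENNReal.ofReal_zero])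
    rw [norm_smul, norm_inv, norm_norm, inv_mul_cancel₀ hz0]
  · change ∫ v, g v ∂T = _
    rw [hT, integral_smul_measure, ENNReal.toReal_ofReal (by positivity),
      integral_finsetSum_measure, smul_eq_mul]
    · congr 1
      refine Finset.sum_congr rfl fun j _ => ?_
      rw [integral_map (hnm j).aemeasurable g.continuous.aestronglyMeasurable, hD,
        integral_withDensity_eq_integral_toReal_smul (hdm j)
          (ae_of_all _ fun _ => ENNReal.ofReal_lt_top)]
      refine integral_congr_ae (ae_of_all _ fun z => ?_)
      simp only [ENNReal.toReal_ofReal (hnn j z), smul_eq_mul]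
      ring
    · intro j _
      exact g.integrable _

end Angular

/-! ### The moving average as a linear image of a finite noise window -/

section Coefficients

variable {Ω E F : Type*} [NormedAddCommGroup E] [NormedSpace ℝ E] [NormedAddCommGroup F]
  [NormedSpace ℝ F] {m : ℕ} (C : Fin (m + 1) → ℤ → Ω → (F →L[ℝ] E))

lemma coeff_fin (i : Fin (m + 1)) (t : ℤ) (ω : Ω) : coeff C (i : ℤ) t ω = C i t ω := by
  have h : (0 : ℤ) ≤ (i : ℤ) ∧ (i : ℤ) ≤ m := ⟨by positivity, by have := i.2; omega⟩
  rw [coeff, dif_pos h]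
  congr 1

lemma coeff_eq_zero {j : ℤ} (hj : ¬(0 ≤ j ∧ j ≤ m)) (t : ℤ) (ω : Ω) : coeff C j t ω = 0 := by
  rw [coeff, dif_neg hj]

/-- Substitution `j = r - i`. Since terms with lag outside `0, …, m` vanish, one window `J` can
serve several times `r` at once. -/
lemma sum_window {M : Type*} [AddCommMonoid M] (J : Finset ℤ) {r : ℤ}
    (hJ : ∀ i : Fin (m + 1), r - (i : ℤ) ∈ J) {φ : ℤ → M}
    (h0 : ∀ j, ¬(0 ≤ r - j ∧ r - j ≤ m) → φ j = 0) :
    ∑ j : J, φ j = ∑ i : Fin (m + 1), φ (r - (i : ℤ)) := by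
  rw [Finset.sum_coe_sort J φ]
  symm
  refine Finset.sum_of_injOn (fun i : Fin (m + 1) => r - (i : ℤ)) ?_ (fun i _ => hJ i) ?_
    fun i _ => rfl
  · intro i _ i' _ h
    ext
    simp only at h
    omega
  · intro j _ hj
    refine h0 j fun hr => hj ⟨⟨(r - j).toNat, by omega⟩, by simp, ?_⟩
    simp only
    omega

lemma movingAverage_eq_sum (ξ : ℤ → Ω → F) (J : Finset ℤ) {r : ℤ}
    (hJ : ∀ i : Fin (m + 1), r - (i : ℤ) ∈ J) (ω : Ω) :
    movingAverage C ξ r ω = ∑ j : J, coeff C (r - (j : ℤ)) r ω (ξ j ω) := by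
  rw [sum_window (m := m) J hJ (φ := fun j => coeff C (r - j) r ω (ξ j ω))]
  · simp only [sub_sub_cancel, coeff_fin]
    rfl
  · intro j hj
    rw [coeff_eq_zero C hj]
    rfl

lemma measurable_coeff [MeasurableSpace Ω] {C : Fin (m + 1) → ℤ → Ω → (F →L[ℝ] E)}
    (hC : ∀ i t, Measurable (C i t)) (j t : ℤ) :
    Measurable (coeff C j t) := by
  by_cases h : 0 ≤ j ∧ j ≤ m
  · have : coeff C j t = C ⟨j.toNat, by omega⟩ t := by ext1 ω; rw [coeff, dif_pos h]
    rw [this]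
    exact hC _ _
  · have : coeff C j t = fun _ => 0 := by ext1 ω; exact coeff_eq_zero C h t ω
    rw [this]
    exact measurable_const

/-- The coefficient operator of the noise at time `j` in the values of the moving average at the
times `τ`. -/
noncomputable def coeffPi {R : Type*} (τ : R → ℤ) (j : ℤ) (ω : Ω) : F →L[ℝ] (R → E) :=
  ContinuousLinearMap.pi fun r => coeff C (τ r - j) (τ r) ω

lemma coeffPi_apply {R : Type*} (τ : R → ℤ) (j : ℤ) (ω : Ω) (z : F) (r : R) :
    coeffPi C τ j ω z r = coeff C (τ r - j) (τ r) ω z := rfl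

lemma sum_coeffPi (ξ : ℤ → Ω → F) (J : Finset ℤ) {R : Type*} {τ : R → ℤ}
    (hτ : ∀ r, ∀ i : Fin (m + 1), τ r - (i : ℤ) ∈ J) (ω : Ω) :
    ∑ j : J, coeffPi C τ j ω (ξ j ω) = fun r => movingAverage C ξ (τ r) ω := by
  ext1 r
  rw [movingAverage_eq_sum C ξ J (hτ r), Finset.sum_apply]
  rfl

lemma norm_coeffPi_le {R : Type*} [Fintype R] (τ : R → ℤ) (j : ℤ) (ω : Ω) :
    ‖coeffPi C τ j ω‖ ≤ ∑ r, ‖coeff C (τ r - j) (τ r) ω‖ := by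
  refine ContinuousLinearMap.opNorm_le_bound _ (Finset.sum_nonneg fun _ _ => norm_nonneg _)
    fun z => ?_
  refine (pi_norm_le_iff_of_nonneg (mul_nonneg (Finset.sum_nonneg fun _ _ => norm_nonneg _)
    (norm_nonneg _))).2 fun r => ?_
  rw [coeffPi_apply]
  refine ((coeff C (τ r - j) (τ r) ω).le_opNorm z).trans ?_
  gcongr
  exact Finset.single_le_sum (f := fun r => ‖coeff C (τ r - j) (τ r) ω‖)
    (fun _ _ => norm_nonneg _) (Finset.mem_univ r)

end Coefficients

/-! ### Stationarity and exceedance asymptotics of the moving average -/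

section MovingAverage

variable {Ω E F : Type*} [MeasurableSpace Ω]
  [NormedAddCommGroup E] [NormedSpace ℝ E] [FiniteDimensional ℝ E]
  [MeasurableSpace E] [BorelSpace E]
  [NormedAddCommGroup F] [NormedSpace ℝ F] [FiniteDimensional ℝ F]
  [MeasurableSpace F] [BorelSpace F]
  {P : Measure Ω} [IsProbabilityMeasure P] {m : ℕ} {α β : ℝ}
  {ξ : ℤ → Ω → F} {C : Fin (m + 1) → ℤ → Ω → (F →L[ℝ] E)}

omit [FiniteDimensional ℝ E] in
lemma measurable_coeff_apply (hC : ∀ i t, Measurable (C i t)) (j t : ℤ) :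
    Measurable fun z : Ω × F => coeff C j t z.1 z.2 :=
  (isBoundedBilinearMap_apply (𝕜 := ℝ) (E := F) (F := E)).continuous.measurable.comp
    (((measurable_coeff hC j t).comp measurable_fst).prodMk measurable_snd)

lemma measurable_movingAverage (hC : ∀ i t, Measurable (C i t)) (hξ : ∀ t, Measurable (ξ t))
    (t : ℤ) : Measurable (movingAverage C ξ t) := by
  have : movingAverage C ξ t = fun ω => ∑ i : Fin (m + 1),
      (coeff C (i : ℤ) t ω) (ξ (t - (i : ℤ)) ω) := by
    ext1 ω
    simp only [coeff_fin]
    rfl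
  rw [this]
  exact Finset.measurable_sum _ fun i _ =>
    (measurable_coeff_apply hC (i : ℤ) t).comp (measurable_id.prodMk (hξ _))

/-- Independence makes the joint law of coefficient and noise paths a product of two shift-invariant
laws. The path of the moving average is a fixed measurable function of this pair that commutes with
shifts. -/
lemma isStationary_movingAverage (hξ_meas : ∀ t, Measurable (ξ t))
    (hC_meas : ∀ i t, Measurable (C i t)) (hξ_indep : iIndepFun ξ P)
    (hξ_ident : ∀ t, IdentDistrib (ξ t) (ξ 0) P P)
    (hC_stat : IsStationary P (fun (t : ℤ) ω (i : Fin (m + 1)) => C i t ω))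
    (hCξ : IndepFun (fun ω (t : ℤ) (i : Fin (m + 1)) => C i t ω) (fun ω (t : ℤ) => ξ t ω) P) :
    IsStationary P (movingAverage C ξ) := by
  intro h
  set Cp : Ω → ℤ → Fin (m + 1) → F →L[ℝ] E := fun ω t i => C i t ω with hCp
  set ξp : Ω → ℤ → F := fun ω t => ξ t ω with hξp
  set Cs : Ω → ℤ → Fin (m + 1) → F →L[ℝ] E := fun ω t i => C i (t + h) ω with hCs
  set ξs : Ω → ℤ → F := fun ω t => ξ (t + h) ω with hξs
  have mCp : Measurable Cp := measurable_pi_lambda _ fun t => measurable_pi_lambda _ fun i =>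
    hC_meas i t
  have mCs : Measurable Cs := measurable_pi_lambda _ fun t => measurable_pi_lambda _ fun i =>
    hC_meas i (t + h)
  have mξp : Measurable ξp := measurable_pi_lambda _ fun t => hξ_meas t
  have mξs : Measurable ξs := measurable_pi_lambda _ fun t => hξ_meas (t + h)
  have hind : IndepFun Cs ξs P := hCξ.comp
    (φ := fun (c : ℤ → Fin (m + 1) → F →L[ℝ] E) t => c (t + h))
    (ψ := fun (w : ℤ → F) t => w (t + h))
    (measurable_pi_lambda _ fun t => measurable_pi_apply _)
    (measurable_pi_lambda _ fun t => measurable_pi_apply _)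
  have lC : P.map Cs = P.map Cp := (hC_stat h).map_eq
  have lξ : P.map ξs = P.map ξp := by
    have h1 := (iIndepFun_iff_map_fun_eq_infinitePi_map hξ_meas).1 hξ_indep
    have h2 := (iIndepFun_iff_map_fun_eq_infinitePi_map fun t => hξ_meas (t + h)).1
      (hξ_indep.precomp (g := fun t : ℤ => t + h) (add_left_injective h))
    rw [hξs, hξp, h1, h2]
    congr 1
    ext1 t
    rw [(hξ_ident t).map_eq, (hξ_ident (t + h)).map_eq]
  have lpair : P.map (fun ω => (Cs ω, ξs ω)) = P.map (fun ω => (Cp ω, ξp ω)) := by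
    rw [(indepFun_iff_map_prod_eq_prod_map_map mCs.aemeasurable mξs.aemeasurable).1 hind,
      (indepFun_iff_map_prod_eq_prod_map_map mCp.aemeasurable mξp.aemeasurable).1 hCξ, lC, lξ]
  have hid : IdentDistrib (fun ω => (Cs ω, ξs ω)) (fun ω => (Cp ω, ξp ω)) P P :=
    ⟨(mCs.prodMk mξs).aemeasurable, (mCp.prodMk mξp).aemeasurable, lpair⟩
  -- That function is the moving average itself, on the path space in place of `Ω`.
  have mΨ : Measurable fun (q : (ℤ → Fin (m + 1) → F →L[ℝ] E) × (ℤ → F)) (t : ℤ) =>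
      movingAverage (fun i t (q : (ℤ → Fin (m + 1) → F →L[ℝ] E) × (ℤ → F)) => q.1 t i)
        (fun t q => q.2 t) t q :=
    measurable_pi_lambda _ fun t => measurable_movingAverage
      (fun i t => (measurable_pi_apply i).comp ((measurable_pi_apply t).comp measurable_fst))
      (fun t => (measurable_pi_apply t).comp measurable_snd) t
  have key := hid.comp mΨ
  convert key using 1
  · ext ω t
    simp only [Function.comp, movingAverage, hCs, hξs]
    refine Finset.sum_congr rfl fun i _ => ?_
    rw [sub_add_eq_add_sub]
  · rfl

omit [MeasurableSpace E] [BorelSpace E] [MeasurableSpace F] [BorelSpace F] in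
lemma memLp_coeff (hC_meas : ∀ i t, Measurable (C i t))
    (hC_stat : IsStationary P (fun (t : ℤ) ω (i : Fin (m + 1)) => C i t ω)) (hβ : 0 < β)
    (hM2 : ∀ i, Integrable (fun ω => ‖C i 0 ω‖ ^ β) P) (j t : ℤ) :
    MemLp (coeff C j t) (ENNReal.ofReal β) P := by
  by_cases h : 0 ≤ j ∧ j ≤ m
  · obtain ⟨i, hi⟩ : ∃ i : Fin (m + 1), (i : ℤ) = j := ⟨⟨j.toNat, by omega⟩, by simp [h.1]⟩
    have e : coeff C j t = C i t := by ext1 ω; rw [← hi, coeff_fin]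
    rw [e]
    have hid : IdentDistrib (C i t) (C i 0) P P := by
      have := (hC_stat t).comp (u := fun c : ℤ → Fin (m + 1) → F →L[ℝ] E => c 0 i)
        ((measurable_pi_apply i).comp (measurable_pi_apply 0))
      simpa [Function.comp_def] using this
    rw [hid.memLp_iff, ← integrable_norm_rpow_iff (hC_meas i 0).aestronglyMeasurable
      (by simpa using hβ) ENNReal.ofReal_ne_top, ENNReal.toReal_ofReal hβ.le]
    exact hM2 i
  · have e : coeff C j t = fun _ => 0 := by ext1 ω; exact coeff_eq_zero C h t ω
    rw [e]
    exact memLp_const 0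

omit [MeasurableSpace E] [BorelSpace E] [MeasurableSpace F] [BorelSpace F] in
lemma memLp_sum_norm_coeff (hC_meas : ∀ i t, Measurable (C i t))
    (hC_stat : IsStationary P (fun (t : ℤ) ω (i : Fin (m + 1)) => C i t ω)) (hβ : 0 < β)
    (hM2 : ∀ i, Integrable (fun ω => ‖C i 0 ω‖ ^ β) P) {R : Type*} [Fintype R] (τ : R → ℤ)
    (j : ℤ) :
    MemLp (fun ω => ∑ r, ‖coeff C (τ r - j) (τ r) ω‖) (ENNReal.ofReal β) P :=
  memLp_finsetSum _ fun r _ => (memLp_coeff hC_meas hC_stat hβ hM2 (τ r - j) (τ r)).norm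

omit [FiniteDimensional ℝ E] in
lemma measurable_coeffPi_apply (hC : ∀ i t, Measurable (C i t)) {R : Type*} (τ : R → ℤ)
    (j : ℤ) : Measurable fun z : Ω × F => coeffPi C τ j z.1 z.2 :=
  measurable_pi_lambda _ fun _ => measurable_coeff_apply hC _ _

lemma integrable_coeffPi_rpow {S : Measure F} [IsProbabilityMeasure S]
    (hS : ∀ᵐ θ ∂S, ‖θ‖ = 1) (hα : 0 < α) (hαβ : α < β)
    (hC_meas : ∀ i t, Measurable (C i t))
    (hC_stat : IsStationary P (fun (t : ℤ) ω (i : Fin (m + 1)) => C i t ω))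
    (hM2 : ∀ i, Integrable (fun ω => ‖C i 0 ω‖ ^ β) P)
    {R : Type*} [Fintype R] (τ : R → ℤ) (j : ℤ) :
    Integrable (fun z : Ω × F => ‖coeffPi C τ j z.1 z.2‖ ^ α) (P.prod S) := by
  have := integrable_mul_norm_rpow (P := P) (S := S) hα hαβ.le hS (B := coeffPi C τ j)
    (measurable_coeffPi_apply hC_meas τ j) (norm_coeffPi_le C τ j)
    (memLp_sum_norm_coeff hC_meas hC_stat (hα.trans hαβ) hM2 τ j)
    (g := fun _ => 1) measurable_const (M := 1) (by simp)
  simpa using this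

/-- Asymptotics of the values of the moving average at the times `τ`, on the exceedances of its
values at the times `σ`. -/
lemma tendsto_setIntegral_movingAverage {S : Measure F} [IsProbabilityMeasure S]
    (hRV : RegVarLaw (P.map (ξ 0)) S α) (hS : ∀ᵐ θ ∂S, ‖θ‖ = 1) (hα : 0 < α) (hαβ : α < β)
    (hξ_meas : ∀ t, Measurable (ξ t))
    (hC_meas : ∀ i t, Measurable (C i t)) (hξ_indep : iIndepFun ξ P)
    (hξ_ident : ∀ t, IdentDistrib (ξ t) (ξ 0) P P)
    (hC_stat : IsStationary P (fun (t : ℤ) ω (i : Fin (m + 1)) => C i t ω))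
    (hCξ : IndepFun (fun ω (t : ℤ) (i : Fin (m + 1)) => C i t ω) (fun ω (t : ℤ) => ξ t ω) P)
    (hM2 : ∀ i, Integrable (fun ω => ‖C i 0 ω‖ ^ β) P)
    {R R' : Type*} [Fintype R] [Fintype R'] (τ : R → ℤ) (σ : R' → ℤ) (J : Finset ℤ)
    (hτ : ∀ r, ∀ i : Fin (m + 1), τ r - (i : ℤ) ∈ J)
    (hσ : ∀ r, ∀ i : Fin (m + 1), σ r - (i : ℤ) ∈ J) (f : (R → E) →ᵇ ℝ) :
    Tendsto (fun x : ℝ => (∫ ω in {ω | x < ‖fun r => movingAverage C ξ (σ r) ω‖},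
        f (‖fun r => movingAverage C ξ (σ r) ω‖⁻¹ • fun r => movingAverage C ξ (τ r) ω) ∂P) /
          tail (P.map (ξ 0)) x) atTop
      (𝓝 (∑ j : J, ∫ z : Ω × F, f (‖coeffPi C σ j z.1 z.2‖⁻¹ • coeffPi C τ j z.1 z.2) *
        ‖coeffPi C σ j z.1 z.2‖ ^ α ∂(P.prod S))) := by
  -- The canonical array on the coefficient path space: evaluated along the path of `C` it returns
  -- `C`, so every coefficient becomes a function of one random element independent of the noise.
  set κ : Fin (m + 1) → ℤ → (ℤ → Fin (m + 1) → F →L[ℝ] E) → F →L[ℝ] E := fun i t c => c t i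
    with hκ
  have mκ : ∀ i t, Measurable (κ i t) := fun i t =>
    (measurable_pi_apply i).comp (measurable_pi_apply t)
  have : IsProbabilityMeasure (P.map (ξ 0)) :=
    Measure.isProbabilityMeasure_map (hξ_meas 0).aemeasurable
  have hlaw : P.map (fun ω (j : J) => ξ j ω) = Measure.pi fun _ : J => P.map (ξ 0) := by
    rw [(iIndepFun_iff_map_fun_eq_pi_map (f := fun j : J => ξ j)
      fun j => (hξ_meas j).aemeasurable).1 (hξ_indep.precomp Subtype.val_injective)]
    congr 1
    ext1 j
    exact (hξ_ident j).map_eq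
  have hind : IndepFun (fun ω (t : ℤ) (i : Fin (m + 1)) => C i t ω)
      (fun ω (j : J) => ξ j ω) P :=
    hCξ.comp (φ := id) (ψ := fun (w : ℤ → F) (j : J) => w j) measurable_id
      (measurable_pi_lambda _ fun j => measurable_pi_apply _)
  have key := hRV.tendsto_setIntegral_random (P := P) hα hαβ hS
    (C := fun ω (t : ℤ) (i : Fin (m + 1)) => C i t ω) (X := fun ω (j : J) => ξ j ω)
    (measurable_pi_lambda _ fun t => measurable_pi_lambda _ fun i => hC_meas i t)
    (measurable_pi_lambda _ fun j => hξ_meas j) hind hlaw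
    (A := fun (j : J) => coeffPi κ τ j) (B := fun (j : J) => coeffPi κ σ j)
    (fun j => measurable_coeffPi_apply mκ τ j) (fun j => measurable_coeffPi_apply mκ σ j)
    (fun j => norm_coeffPi_le C σ j)
    (fun j => memLp_sum_norm_coeff hC_meas hC_stat (hα.trans hαβ) hM2 σ j) f
  have eτ : ∀ (j : ℤ) (ω : Ω),
      coeffPi κ τ j (fun (t : ℤ) (i : Fin (m + 1)) => C i t ω) = coeffPi C τ j ω :=
    fun j ω => rfl
  have eσ : ∀ (j : ℤ) (ω : Ω),
      coeffPi κ σ j (fun (t : ℤ) (i : Fin (m + 1)) => C i t ω) = coeffPi C σ j ω :=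
    fun j ω => rfl
  simp only [eτ, eσ, sum_coeffPi C ξ J hτ, sum_coeffPi C ξ J hσ] at key
  exact key

end MovingAverage

/-! ### Joint regular variation and the limit given an exceedance at time zero -/

section Main

variable {Ω E F : Type*} [MeasurableSpace Ω]
  [NormedAddCommGroup E] [NormedSpace ℝ E] [FiniteDimensional ℝ E]
  [MeasurableSpace E] [BorelSpace E]
  [NormedAddCommGroup F] [NormedSpace ℝ F] [FiniteDimensional ℝ F]
  [MeasurableSpace F] [BorelSpace F]
  {P : Measure Ω} [IsProbabilityMeasure P] {m : ℕ} {α β : ℝ}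
  {ξ : ℤ → Ω → F} {C : Fin (m + 1) → ℤ → Ω → (F →L[ℝ] E)}

omit [FiniteDimensional ℝ E] [MeasurableSpace E] [BorelSpace E] [FiniteDimensional ℝ F]
  [BorelSpace F] [IsProbabilityMeasure P] in
-- The noise at time `-i` enters time `0` with coefficient `i` and time `τ r` with coefficient `i +
-- τ r`. All other noise times have weight `0 ^ α = 0`.
lemma sum_integral_coeffPi_zero (S : Measure F) (hα : 0 < α) (J : Finset ℤ)
    (hJ : ∀ i : Fin (m + 1), 0 - (i : ℤ) ∈ J) {R : Type*} (τ : R → ℤ) (f : (R → E) → ℝ) :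
    ∑ j : J, ∫ z : Ω × F, f (‖coeffPi C (fun _ : Unit => 0) j z.1 z.2‖⁻¹ •
        coeffPi C τ j z.1 z.2) * ‖coeffPi C (fun _ : Unit => 0) j z.1 z.2‖ ^ α ∂(P.prod S) =
      ∑ i : Fin (m + 1), ∫ z : Ω × F,
        f (fun r => ‖C i 0 z.1 z.2‖⁻¹ • coeff C ((i : ℤ) + τ r) (τ r) z.1 z.2) *
          ‖C i 0 z.1 z.2‖ ^ α ∂(P.prod S) := by
  have hn : ∀ (j : ℤ) (z : Ω × F), ‖coeffPi C (fun _ : Unit => 0) j z.1 z.2‖ =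
      ‖coeff C (0 - j) 0 z.1 z.2‖ := fun j z => pi_norm_const (ι := Unit) _
  simp_rw [hn]
  rw [sum_window (m := m) J hJ (φ := fun j => ∫ z : Ω × F, f (‖coeff C (0 - j) 0 z.1 z.2‖⁻¹ •
    coeffPi C τ j z.1 z.2) * ‖coeff C (0 - j) 0 z.1 z.2‖ ^ α ∂(P.prod S))]
  · refine Finset.sum_congr rfl fun i _ => ?_
    simp only [sub_sub_cancel, coeff_fin]
    refine integral_congr_ae (ae_of_all _ fun z => ?_)
    simp only
    congr 2
    ext1 r
    rw [Pi.smul_apply, coeffPi_apply]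
    congr 3
    ring
  · intro j hj
    refine integral_eq_zero_of_ae (ae_of_all _ fun z => ?_)
    simp only [coeff_eq_zero C hj, zero_apply, norm_zero,
      Real.zero_rpow hα.ne', mul_zero, Pi.zero_apply]

/-- Asymptotics of a stretch of the moving average on the exceedances of its norm at time `0`. -/
lemma tendsto_setIntegral_exceedance {S : Measure F} [IsProbabilityMeasure S]
    (hRV : RegVarLaw (P.map (ξ 0)) S α) (hS : ∀ᵐ θ ∂S, ‖θ‖ = 1) (hα : 0 < α) (hαβ : α < β)
    (hξ_meas : ∀ t, Measurable (ξ t))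
    (hC_meas : ∀ i t, Measurable (C i t)) (hξ_indep : iIndepFun ξ P)
    (hξ_ident : ∀ t, IdentDistrib (ξ t) (ξ 0) P P)
    (hC_stat : IsStationary P (fun (t : ℤ) ω (i : Fin (m + 1)) => C i t ω))
    (hCξ : IndepFun (fun ω (t : ℤ) (i : Fin (m + 1)) => C i t ω) (fun ω (t : ℤ) => ξ t ω) P)
    (hM2 : ∀ i, Integrable (fun ω => ‖C i 0 ω‖ ^ β) P) (s t : ℤ)
    (f : (Set.Icc s t → E) →ᵇ ℝ) :
    Tendsto (fun x : ℝ => (∫ ω in {ω | x < ‖movingAverage C ξ 0 ω‖},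
        f (fun r => ‖movingAverage C ξ 0 ω‖⁻¹ • movingAverage C ξ r ω) ∂P) /
          P.real {ω | x < ‖ξ 0 ω‖}) atTop
      (𝓝 (∑ i : Fin (m + 1), ∫ z : Ω × F,
        f (fun r => ‖C i 0 z.1 z.2‖⁻¹ • coeff C ((i : ℤ) + r) r z.1 z.2) *
          ‖C i 0 z.1 z.2‖ ^ α ∂(P.prod S))) := by
  -- The window must cover the noise behind time `0` as well as behind `s, …, t`, which need not
  -- contain `0`.
  set J : Finset ℤ := Finset.Icc (min s 0 - m) (max t 0) with hJ
  have hJ0 : ∀ i : Fin (m + 1), 0 - (i : ℤ) ∈ J := fun i => by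
    have := i.2
    rw [hJ, Finset.mem_Icc]
    omega
  have key := tendsto_setIntegral_movingAverage hRV hS hα hαβ hξ_meas hC_meas hξ_indep hξ_ident
    hC_stat hCξ hM2 (fun r : Set.Icc s t => (r : ℤ)) (fun _ : Unit => 0) J
    (fun r i => by
      have := i.2
      have h1 := r.2.1
      have h2 := r.2.2
      rw [hJ, Finset.mem_Icc]
      omega) (fun _ => hJ0) f
  rw [sum_integral_coeffPi_zero S hα J hJ0 (fun r : Set.Icc s t => (r : ℤ)) f] at key
  have hn : ∀ ω, ‖fun _ : Unit => movingAverage C ξ 0 ω‖ = ‖movingAverage C ξ 0 ω‖ := fun ω =>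
    pi_norm_const (ι := Unit) _
  simp only [hn, tail_map (hξ_meas 0)] at key
  exact key

omit [FiniteDimensional ℝ E] [MeasurableSpace E] [BorelSpace E] [FiniteDimensional ℝ F]
  [BorelSpace F] [IsProbabilityMeasure P] in
lemma tailConstant_pos {S : ProbabilityMeasure F}
    (hint : ∀ i, Integrable (fun z : Ω × F => ‖C i 0 z.1 z.2‖ ^ α) (P.prod (S : Measure F)))
    (hM3 : ∃ i, 0 < (P.prod (S : Measure F)) {z | 0 < ‖C i 0 z.1 z.2‖}) :
    0 < tailConstant P S α C := by
  have hnn : ∀ i, 0 ≤ fun z : Ω × F => ‖C i 0 z.1 z.2‖ ^ α := fun i z => by positivity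
  obtain ⟨i, hi⟩ := hM3
  refine Finset.sum_pos' (fun i _ => integral_nonneg (hnn i)) ⟨i, Finset.mem_univ i, ?_⟩
  rw [integral_pos_iff_support_of_nonneg (hnn i) (hint i)]
  refine hi.trans_le (measure_mono fun z hz => ?_)
  exact (Real.rpow_pos_of_pos hz α).ne'

/-- With the stretch both observed and conditioned on, in the supremum norm, the limits are angular
integrals weighted by `‖coeffPi C τ j‖ ^ α`. Normalised, these define the spectral law. -/
lemma isRegularlyVarying_stretch {S : Measure F} [IsProbabilityMeasure S]
    (hRV : RegVarLaw (P.map (ξ 0)) S α) (hS : ∀ᵐ θ ∂S, ‖θ‖ = 1) (hα : 0 < α) (hαβ : α < β)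
    (hξ_meas : ∀ t, Measurable (ξ t))
    (hC_meas : ∀ i t, Measurable (C i t)) (hξ_indep : iIndepFun ξ P)
    (hξ_ident : ∀ t, IdentDistrib (ξ t) (ξ 0) P P)
    (hC_stat : IsStationary P (fun (t : ℤ) ω (i : Fin (m + 1)) => C i t ω))
    (hCξ : IndepFun (fun ω (t : ℤ) (i : Fin (m + 1)) => C i t ω) (fun ω (t : ℤ) => ξ t ω) P)
    (hM2 : ∀ i, Integrable (fun ω => ‖C i 0 ω‖ ^ β) P) {c : ℝ} (hc : 0 < c)
    (hratio : Tendsto (fun x : ℝ =>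
      P.real {ω | x < ‖movingAverage C ξ 0 ω‖} / P.real {ω | x < ‖ξ 0 ω‖}) atTop (𝓝 c))
    {k : ℕ} (hk : 1 ≤ k) :
    IsRegularlyVarying P α (fun ω (j : Fin k) => movingAverage C ξ ((j : ℤ) + 1) ω) := by
  have : IsProbabilityMeasure (P.map (ξ 0)) :=
    Measure.isProbabilityMeasure_map (hξ_meas 0).aemeasurable
  set τ : Fin k → ℤ := fun j => (j : ℤ) + 1 with hτ
  set Y : Ω → Fin k → E := fun ω j => movingAverage C ξ (τ j) ω with hY
  have mX := measurable_movingAverage hC_meas hξ_meas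
  have mY : Measurable Y := measurable_pi_lambda _ fun j => mX _
  set J : Finset ℤ := Finset.Icc (-(m : ℤ)) k with hJ
  have hτJ : ∀ r, ∀ i : Fin (m + 1), τ r - (i : ℤ) ∈ J := fun r i => by
    have := i.2
    have := r.2
    rw [hJ, Finset.mem_Icc]
    simp only [hτ]
    omega
  have key := tendsto_setIntegral_movingAverage hRV hS hα hαβ hξ_meas hC_meas hξ_indep hξ_ident
    hC_stat hCξ hM2 τ τ J hτJ hτJ
  set cY := ∑ j : J, ∫ z : Ω × F, ‖coeffPi C τ j z.1 z.2‖ ^ α ∂(P.prod S) with hcY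
  have hmass : Tendsto (fun x : ℝ => P.real {ω | x < ‖Y ω‖} / tail (P.map (ξ 0)) x) atTop
      (𝓝 cY) := by
    simpa [hcY] using key (BoundedContinuousFunction.const _ 1)
  -- The norm of the stretch dominates that of its first entry, which has the law of the value at
  -- time `0`; hence `c ≤ cY`.
  have hcY0 : 0 < cY := by
    refine hc.trans_le (le_of_tendsto_of_tendsto' hratio hmass fun x => ?_)
    rw [tail_map (hξ_meas 0)]
    refine div_le_div_of_nonneg_right ?_ measureReal_nonneg
    have hst := isStationary_movingAverage hξ_meas hC_meas hξ_indep hξ_ident hC_stat hCξ 1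
    have hst2 := (hst.comp (u := fun w : ℤ → E => w 0) (measurable_pi_apply 0)).measure_mem_eq
      (measurableSet_lt_norm x)
    have hst3 : P.real {ω | x < ‖movingAverage C ξ 1 ω‖} =
        P.real {ω | x < ‖movingAverage C ξ 0 ω‖} := congrArg ENNReal.toReal hst2
    rw [← hst3]
    refine measureReal_mono fun ω (hω : x < _) => show x < ‖Y ω‖ from hω.trans_le ?_
    have := norm_le_pi_norm (Y ω) ⟨0, hk⟩
    simpa [hY, hτ] using this
  obtain ⟨S', hS', hint'⟩ := exists_angular_law (Q := P.prod S)
    (Y := fun (j : J) z => coeffPi C τ j z.1 z.2)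
    (fun j => measurable_coeffPi_apply hC_meas τ j) hα
    (fun j => integrable_coeffPi_rpow hS hα hαβ hC_meas hC_stat hM2 τ j) hcY0 hcY
  refine ⟨normSeminorm ℝ _, S', hα, fun v hv => norm_eq_zero.1 hv, hS', fun u hu => ?_⟩
  rw [tendsto_angularMeasure_iff mY]
  intro g
  have hu' : (0 : ℝ) < u := hu
  -- The limit is taken along `u * x`; passing from `tail (u * x)` back to `tail x` produces the
  -- factor `u ^ (-α)`.
  have h1 := (key g).comp (tendsto_id.const_mul_atTop hu')
  have h2 := (h1.mul (hRV.tendsto_tail hu')).div hmass hcY0.ne'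
  refine (h2.congr fun x => ?_).trans_eq ?_
  · have hV := (hRV.tail_pos x).ne'
    have hV' := (hRV.tail_pos (u * x)).ne'
    simp only [Function.comp, id, Pi.div_apply, hY]
    rw [div_mul_div_cancel₀ hV', div_div_div_cancel_right₀ hV]
  · rw [hint' g]
    congr 1
    field_simp

end Main

end MMA

theorem theorem2p8
    {Ω E F : Type*} [MeasurableSpace Ω]
    [NormedAddCommGroup E] [NormedSpace ℝ E] [FiniteDimensional ℝ E]
    [MeasurableSpace E] [BorelSpace E]
    [NormedAddCommGroup F] [NormedSpace ℝ F] [FiniteDimensional ℝ F]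
    [MeasurableSpace F] [BorelSpace F]
    (P : Measure Ω) [IsProbabilityMeasure P]
    (m : ℕ) (α : ℝ)
    (ξ : ℤ → Ω → F) (C : Fin (m + 1) → ℤ → Ω → (F →L[ℝ] E))
    (hξ_meas : ∀ t, Measurable (ξ t))
    (hC_meas : ∀ i t, Measurable (C i t))
    (hξ_indep : iIndepFun ξ P)
    (hξ_ident : ∀ t, IdentDistrib (ξ t) (ξ 0) P P)
    (hC_stat : MMA.IsStationary P (fun (t : ℤ) ω (i : Fin (m + 1)) => C i t ω))
    (hCξ : IndepFun (fun ω (t : ℤ) (i : Fin (m + 1)) => C i t ω) (fun ω (t : ℤ) => ξ t ω) P)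
    (S : ProbabilityMeasure F)
    (hM1 : MMA.IsRegularlyVaryingWith P (normSeminorm ℝ F) α (ξ 0) S)
    (hM2 : ∃ β : ℝ, α < β ∧ ∀ i, Integrable (fun ω => ‖C i 0 ω‖ ^ β) P)
    (hM3 : ∃ i, 0 < (P.prod (S : Measure F)) {z | 0 < ‖C i 0 z.1 z.2‖}) :
    MMA.IsJointlyRegularlyVarying P α (MMA.movingAverage C ξ) ∧
    (∀ i, Integrable (fun z : Ω × F => ‖C i 0 z.1 z.2‖ ^ α) (P.prod (S : Measure F))) ∧
    0 < MMA.tailConstant P S α C ∧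
    Tendsto (fun x : ℝ =>
        P.real {ω | x < ‖MMA.movingAverage C ξ 0 ω‖} / P.real {ω | x < ‖ξ 0 ω‖})
      atTop (𝓝 (MMA.tailConstant P S α C)) ∧
    ∀ s t : ℤ, s ≤ t → ∀ f : (Set.Icc s t → E) →ᵇ ℝ,
      Tendsto (fun x : ℝ =>
          ∫ ω, f (fun r => ‖MMA.movingAverage C ξ 0 ω‖⁻¹ • MMA.movingAverage C ξ r ω)
            ∂(P[|{ω | x < ‖MMA.movingAverage C ξ 0 ω‖}]))
        atTop
        (𝓝 ((MMA.tailConstant P S α C)⁻¹ *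
          ∑ i : Fin (m + 1), ∫ z : Ω × F,
            f (fun r => ‖C i 0 z.1 z.2‖⁻¹ • MMA.coeff C ((i : ℤ) + r) r z.1 z.2) *
              ‖C i 0 z.1 z.2‖ ^ α ∂(P.prod (S : Measure F)))) := by
  obtain ⟨β, hαβ, hM2⟩ := hM2
  have hα := hM1.index_pos
  have hS : ∀ᵐ θ ∂(S : Measure F), ‖θ‖ = 1 := hM1.sphere
  have hRV := hM1.regVarLaw (hξ_meas 0)
  have : IsProbabilityMeasure (P.map (ξ 0)) :=
    Measure.isProbabilityMeasure_map (hξ_meas 0).aemeasurable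
  have hint : ∀ i, Integrable (fun z : Ω × F => ‖C i 0 z.1 z.2‖ ^ α)
      (P.prod (S : Measure F)) := fun i => by
    have h := MMA.integrable_coeffPi_rpow (P := P) hS hα hαβ hC_meas hC_stat hM2
      (fun _ : Unit => 0) (-(i : ℤ))
    refine h.congr (ae_of_all _ fun z => ?_)
    have e : ‖MMA.coeffPi C (fun _ : Unit => 0) (-(i : ℤ)) z.1 z.2‖ = ‖C i 0 z.1 z.2‖ := by
      have e2 : ‖MMA.coeffPi C (fun _ : Unit => 0) (-(i : ℤ)) z.1 z.2‖ =
        ‖MMA.coeff C (0 - -(i : ℤ)) 0 z.1 z.2‖ := pi_norm_const (ι := Unit) _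
      rwa [sub_neg_eq_add, zero_add, MMA.coeff_fin] at e2
    simp only [e]
  have hc := MMA.tailConstant_pos hint hM3
  have key := MMA.tendsto_setIntegral_exceedance hRV hS hα hαβ hξ_meas hC_meas hξ_indep hξ_ident
    hC_stat hCξ hM2
  have hratio : Tendsto (fun x : ℝ =>
      P.real {ω | x < ‖MMA.movingAverage C ξ 0 ω‖} / P.real {ω | x < ‖ξ 0 ω‖})
      atTop (𝓝 (MMA.tailConstant P S α C)) := by
    -- The constant test function `1` reduces the exceedance limit to the ratio of tails.
    simpa [MMA.tailConstant] using key 0 0 (BoundedContinuousFunction.const _ 1)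
  refine ⟨⟨MMA.isStationary_movingAverage hξ_meas hC_meas hξ_indep hξ_ident hC_stat hCξ,
    fun k hk => MMA.isRegularlyVarying_stretch hRV hS hα hαβ hξ_meas hC_meas hξ_indep hξ_ident
      hC_stat hCξ hM2 hc hratio hk⟩, hint, hc, hratio, fun s t _ f => ?_⟩
  -- Both limits are normalised by the tail of `ξ 0`, which cancels and leaves the conditional
  -- expectation.
  have h := (key s t f).div hratio hc.ne'
  rw [div_eq_inv_mul (∑ i, _)] at h
  refine h.congr fun x => ?_
  have hV : P.real {ω | x < ‖ξ 0 ω‖} ≠ 0 := by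
    rw [← MMA.tail_map (hξ_meas 0)]
    exact (hRV.tail_pos x).ne'
  rw [Pi.div_apply, div_div_div_cancel_right₀ hV, ProbabilityTheory.cond, integral_smul_measure,
    ENNReal.toReal_inv, smul_eq_mul, div_eq_inv_mul]
  rfl
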